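/- \textbf{Setting.} Let $\alpha>2$, $\beta>0$, $P_0>0$, $\sigma^2\ge 0$, $0\le R_{\rm in}<R_{\rm out}$, $R_c\ge 0$, $M\in\mathbb N$, $m\in\mathbb R$, $v\ge 0$. Put $$g(d)=\beta(d+1)^{-\alpha},\qquad G(r,y,\psi)=g(y)\,g\big(\sqrt{r^2+y^2-2ry\cos\psi}\big),\qquad s=s(r)=\frac1{P_0g(r)}.$$ Let $\mathcal L_D(w)=\mathbb E[e^{-w|\rho_D|^2}]$ with $|\rho_D|^2$ exponential of mean one (Rayleigh fading), and $\mathcal L_R(w)=\mathbb E[e^{-w|\rho_R|^2}]$ with $|\rho_R|$ Gaussian $\mathcal N(Mm,Mv)$, where $m$ and $v$ are the mean and variance of the fading amplitude of one reflecting element. For $z\in\mathbb C$, $r\ge R_c$ and a threshold $t>0$ let $$E_{\rm BS}(z)=2\pi\int_r^\infty x\big(1-\mathcal L_D(z\,t\,P_0g(x))\big)dx,\qquad E_{\rm RIS}(z)=\int_{R_{\rm in}}^{R_{\rm out}}\int_0^{2\pi}y\big(1-\mathcal L_R(-zP_0G(r,y,\psi))\big)d\psi\,dy,$$ and let the Laplace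 transform of $\Upsilon=t(I+\sigma^2)-S_R$ (interference plus noise, scaled by $t$, minus reflected signal) be $$\mathcal B_\Upsilon(z)=e^{-\lambda_{\rm BS}E_{\rm BS}(z)}\,e^{-zt\sigma^2}\,e^{-\lambda_{\rm RIS}E_{\rm RIS}(z)} .$$ Its region of convergence is the vertical strip of all $z$ with $\Re z\cdot tP_0g(x)>-1$ for all $x\ge r$ and $2Mv\,\Re z\cdot P_0G(r,y,\psi)<1$ for all $y\in[R_{\rm in},R_{\rm out}]$, $\psi\in[0,2\pi]$. The coverage formula is $$\mathcal B_{\Upsilon^+}(s)=\frac1{2\pi\imath}\,\mathrm{p.v.}\!\!\int_{-\infty}^\infty\big(\mathcal B_\Upsilon(s-\imath u)-\mathcal B_\Upsilon(-\imath u)\big)\frac{du}u+\frac{1+\mathcal B_\Upsilon(s)}2 ,$$ with $\mathrm{p.v.}\int=\lim_{\epsilon\downarrow0}\big(\int_{-\infty}^{-\epsilon}+\int_\epsilon^\infty\big)$, and the mean ergodic rate is $$\tau=\int_0^\infty\int_{R_c}^\infty\mathcal B_{\Upsilon^+}(s)\,2\pi\lambda_{\rm BS}\,r\,e^{-\pi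 r^2\lambda_{\rm BS}}\,\frac1{1+t}\,dr\,dt .$$ \textbf{Statement.} Suppose that for every $r\ge R_c$ and $t>0$ the point $s(r)$ lies in the region of convergence of $\mathcal B_\Upsilon$. Let $\lambda_{\rm BS}>0$ and $\lambda_{\rm RIS}\ge0$. (At $\lambda_{\rm RIS}=0$, derivatives in $\lambda_{\rm RIS}$ are two-sided derivatives of the expressions above, which make sense for all real $\lambda_{\rm RIS}$.) Then: (0) $\mathcal L_D(w)=\frac1{1+w}$ if $\Re w>-1$, and $\mathcal L_R(w)=(1+2wMv)^{-1/2}\exp\!\Big(\frac{-w(Mm)^2}{1+2wMv}\Big)$ (principal branch) if $2Mv\,\Re w>-1$. (1) For $r\ge R_c$, $t>0$ and every $z$ in the region of convergence, the integrals $E_{\rm BS}(z)$ and $E_{\rm RIS}(z)$ converge absolutely, and $$\frac{\partial\mathcal B_\Upsilon(z)}{\partial\lambda_{\rm BS}}=-\mathcal B_\Upsilon(z)\cdot2\pi\int_r^\infty x\big(1-\mathcal L_D(z\,t\,P_0g(x))\big)dx,$$ $$\frac{\partial\mathcal B_\Upsilon(z)}{\partial\lambda_{\rm RIS}}=-\mathcal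 B_\Upsilon(z)\int_{R_{\rm in}}^{R_{\rm out}}\int_0^{2\pi}y\big(1-\mathcal L_R(-zP_0G(r,y,\psi))\big)d\psi\,dy .$$ (2) For $r\ge R_c$, $t>0$ and $\lambda\in\{\lambda_{\rm BS},\lambda_{\rm RIS}\}$, the principal-value integral in $\mathcal B_{\Upsilon^+}(s)$ and the one obtained by replacing $\mathcal B_\Upsilon$ by $\partial\mathcal B_\Upsilon/\partial\lambda$ converge (absolutely on $|u|>\epsilon$ for every $\epsilon>0$, and with a limit as $\epsilon\downarrow0$), and $$\frac{\partial}{\partial\lambda}\,\mathrm{p.v.}\!\!\int_{-\infty}^\infty\big(\mathcal B_\Upsilon(s-\imath u)-\mathcal B_\Upsilon(-\imath u)\big)\frac{du}u=\mathrm{p.v.}\!\!\int_{-\infty}^\infty\Big(\frac{\partial\mathcal B_\Upsilon(s-\imath u)}{\partial\lambda}-\frac{\partial\mathcal B_\Upsilon(-\imath u)}{\partial\lambda}\Big)\frac{du}u .$$ Moreover $\mathcal B_{\Upsilon^+}(s)$ is real, and it is differentiable in $\lambda$ with $$\frac{\partial\mathcal B_{\Upsilon^+}(s)}{\partial\lambda}=\frac1{2\pi\imath}\,\mathrm{p.v.}\!\!\int_{-\infty}^\infty\Big(\frac{\partial\mathcal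 B_\Upsilon(s-\imath u)}{\partial\lambda}-\frac{\partial\mathcal B_\Upsilon(-\imath u)}{\partial\lambda}\Big)\frac{du}u+\frac12\frac{\partial\mathcal B_\Upsilon(s)}{\partial\lambda}.$$ (3) For every $t>0$, the function $r\mapsto\mathcal B_{\Upsilon^+}(s)\,2\pi\lambda_{\rm BS}re^{-\pi r^2\lambda_{\rm BS}}$ and its derivatives in $\lambda_{\rm BS}$ and $\lambda_{\rm RIS}$, namely $$\Big(\frac{\partial\mathcal B_{\Upsilon^+}(s)}{\partial\lambda_{\rm BS}}\lambda_{\rm BS}+\mathcal B_{\Upsilon^+}(s)(1-\pi r^2\lambda_{\rm BS})\Big)2\pi re^{-\pi r^2\lambda_{\rm BS}}\quad\text{and}\quad\frac{\partial\mathcal B_{\Upsilon^+}(s)}{\partial\lambda_{\rm RIS}}2\pi\lambda_{\rm BS}re^{-\pi r^2\lambda_{\rm BS}},$$ are integrable on $(R_c,\infty)$, and both derivatives may be taken under the integral over $r$. (4) The three resulting integrals over $r$, multiplied by $\frac1{1+t}$, are integrable in $t$ over $(0,\infty)$; $\tau$ is differentiable in $\lambda_{\rm BS}$ and in $\lambda_{\rm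 RIS}$, and $$\frac{\partial\tau}{\partial\lambda_{\rm BS}}=\int_0^\infty\int_{R_c}^\infty\Big(\frac{\partial\mathcal B_{\Upsilon^+}(s)}{\partial\lambda_{\rm BS}}\lambda_{\rm BS}+\mathcal B_{\Upsilon^+}(s)(1-\pi r^2\lambda_{\rm BS})\Big)2\pi re^{-\pi r^2\lambda_{\rm BS}}\frac1{1+t}\,dr\,dt,$$ $$\frac{\partial\tau}{\partial\lambda_{\rm RIS}}=\int_0^\infty\int_{R_c}^\infty\frac{\partial\mathcal B_{\Upsilon^+}(s)}{\partial\lambda_{\rm RIS}}\,2\pi\lambda_{\rm BS}\,re^{-\pi r^2\lambda_{\rm BS}}\frac1{1+t}\,dr\,dt .$$ -/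

import Mathlib

open MeasureTheory ProbabilityTheory Set Filter Topology

noncomputable section

/-- The numerical parameters of the RIS-assisted cellular network, apart from the two densities. -/
structure RISNetwork where
  /-- path-loss exponent -/
  α : ℝ
  /-- average power gain at the reference distance -/
  β : ℝ
  /-- transmission power -/
  P₀ : ℝ
  /-- noise power (the quantity written `σ²`) -/
  noise : ℝ
  /-- inner radius of an RIS cluster ring -/
  Rin : ℝ
  /-- outer radius of an RIS cluster ring -/
  Rout : ℝ
  /-- radius of the guard zone -/
  Rc : ℝ
  /-- number of elements of an RIS panel -/
  M : ℕ
  /-- mean of `|ζ|`, the fading amplitude of one RIS element -/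
  meanZ : ℝ
  /-- variance of `|ζ|` -/
  varZ : NNReal

namespace RISNetwork

/-- The standing assumptions on the parameters. -/
structure Admissible (p : RISNetwork) : Prop where
  two_lt_α : 2 < p.α
  β_pos : 0 < p.β
  P₀_pos : 0 < p.P₀
  noise_nonneg : 0 ≤ p.noise
  Rin_nonneg : 0 ≤ p.Rin
  Rin_lt_Rout : p.Rin < p.Rout
  Rc_nonneg : 0 ≤ p.Rc

/-- The path-loss function `g(d) = β (d + 1)^(-α)`. -/
def g (p : RISNetwork) (d : ℝ) : ℝ := p.β * (d + 1) ^ (-p.α)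

/-- The path-loss of a reflected path, `G(r,y,ψ) = g(y) g(√(r² + y² - 2 r y cos ψ))`. -/
def G (p : RISNetwork) (r y ψ : ℝ) : ℝ :=
  p.g y * p.g (Real.sqrt (r ^ 2 + y ^ 2 - 2 * r * y * Real.cos ψ))

/-- Laplace transform `w ↦ E[exp(-w |ρ_D|²)]` of the power of a Rayleigh fading, which has the
exponential law of mean one. -/
def LD (w : ℂ) : ℂ := complexMGF id (expMeasure 1) (-w)

/-- Laplace transform `w ↦ E[exp(-w |ρ_R|²)]` of the power of the fading of a reflected beam, where
`|ρ_R|` is Gaussian with mean `M E|ζ|` and variance `M V|ζ|`. -/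
def LR (p : RISNetwork) (w : ℂ) : ℂ :=
  complexMGF (fun x : ℝ => x ^ 2) (gaussianReal (p.M * p.meanZ) (p.M * p.varZ)) (-w)

/-- `2π ∫_r^∞ x (1 - L_D(z t P₀ g(x))) dx`. -/
def expoBS (p : RISNetwork) (r t : ℝ) (z : ℂ) : ℂ :=
  2 * (Real.pi : ℂ) *
    ∫ x in Ioi r, (x : ℂ) * (1 - LD (z * ((t * p.P₀ * p.g x : ℝ) : ℂ)))

/-- `∫_{Rin}^{Rout} ∫_0^{2π} y (1 - L_R(-z P₀ G(r,y,ψ))) dψ dy`. -/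
def expoRIS (p : RISNetwork) (r : ℝ) (z : ℂ) : ℂ :=
  ∫ y in p.Rin..p.Rout, ∫ ψ in (0 : ℝ)..(2 * Real.pi),
    (y : ℂ) * (1 - p.LR (-(z * ((p.P₀ * p.G r y ψ : ℝ) : ℂ))))

/-- The bilateral Laplace transform of `Υ = t (I + σ²) - S_R`, for a user at distance `r` from its
base station and threshold `t`: the product of the transforms of the scaled interference power,
of the scaled noise power and of the reflected signal power. -/
def B (p : RISNetwork) (lB lR r t : ℝ) (z : ℂ) : ℂ :=
  Complex.exp (-((lB : ℂ) * p.expoBS r t z))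
    * Complex.exp (-(z * ((t * p.noise : ℝ) : ℂ)))
    * Complex.exp (-((lR : ℂ) * p.expoRIS r z))

/-- The region of convergence of `B`: the vertical strip of all `z` for which the fading laws have
finite exponential moments at the (real parts of the) arguments at which they are used. -/
def roc (p : RISNetwork) (r t : ℝ) : Set ℂ :=
  {z | (∀ x, r ≤ x → -1 < z.re * (t * p.P₀ * p.g x)) ∧
    ∀ y ∈ Icc p.Rin p.Rout, ∀ ψ ∈ Icc (0 : ℝ) (2 * Real.pi),
      2 * (p.M * p.varZ) * (z.re * (p.P₀ * p.G r y ψ)) < 1}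

/-- The argument `s = 1 / (P₀ g(r))` at which the coverage formula is evaluated. -/
def sArg (p : RISNetwork) (r : ℝ) : ℂ := ((1 / (p.P₀ * p.g r) : ℝ) : ℂ)

/-- `∂B/∂λ_BS` in explicit form. -/
def dB_BS (p : RISNetwork) (lB lR r t : ℝ) (z : ℂ) : ℂ := -(p.B lB lR r t z * p.expoBS r t z)

/-- `∂B/∂λ_RIS` in explicit form. -/
def dB_RIS (p : RISNetwork) (lB lR r t : ℝ) (z : ℂ) : ℂ := -(p.B lB lR r t z * p.expoRIS r z)

end RISNetwork

/-- `∫_{-∞}^{-ε} F(u) du/u + ∫_ε^∞ F(u) du/u`. -/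
def pvTrunc (F : ℝ → ℂ) (ε : ℝ) : ℂ :=
  (∫ u in Iio (-ε), F u / (u : ℂ)) + ∫ u in Ioi ε, F u / (u : ℂ)

/-- The principal-value integral of `F(u) du/u` over the line converges. -/
def PVConverges (F : ℝ → ℂ) : Prop :=
  (∀ ε : ℝ, 0 < ε → IntegrableOn (fun u : ℝ => F u / (u : ℂ)) (Iio (-ε)) ∧
    IntegrableOn (fun u : ℝ => F u / (u : ℂ)) (Ioi ε)) ∧
  ∃ l : ℂ, Tendsto (pvTrunc F) (𝓝[>] 0) (𝓝 l)

/-- The Cauchy principal value of `∫ F(u) du/u` over the line. -/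
def pvIntegral (F : ℝ → ℂ) : ℂ := limUnder (𝓝[>] (0 : ℝ)) (pvTrunc F)

/-- The numerator `F(s - i u) - F(-i u)` of the singular integrals. -/
def pvNum (F : ℂ → ℂ) (s : ℂ) (u : ℝ) : ℂ :=
  F (s - Complex.I * (u : ℂ)) - F (-(Complex.I * (u : ℂ)))

namespace RISNetwork

/-- The coverage formula `B_{Υ⁺}(s)` at `s = 1 / (P₀ g(r))`. -/
def cov (p : RISNetwork) (lB lR r t : ℝ) : ℂ :=
  1 / (2 * (Real.pi : ℂ) * Complex.I) * pvIntegral (pvNum (p.B lB lR r t) (p.sArg r))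
    + (1 + p.B lB lR r t (p.sArg r)) / 2

/-- `∂B_{Υ⁺}(s)/∂λ_BS` in explicit form. -/
def dCov_BS (p : RISNetwork) (lB lR r t : ℝ) : ℂ :=
  1 / (2 * (Real.pi : ℂ) * Complex.I) * pvIntegral (pvNum (p.dB_BS lB lR r t) (p.sArg r))
    + 1 / 2 * p.dB_BS lB lR r t (p.sArg r)

/-- `∂B_{Υ⁺}(s)/∂λ_RIS` in explicit form. -/
def dCov_RIS (p : RISNetwork) (lB lR r t : ℝ) : ℂ :=
  1 / (2 * (Real.pi : ℂ) * Complex.I) * pvIntegral (pvNum (p.dB_RIS lB lR r t) (p.sArg r))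
    + 1 / 2 * p.dB_RIS lB lR r t (p.sArg r)

/-- `B_{Υ⁺}(s)` times the density `2π λ_BS r exp(-π r² λ_BS)` of the distance to the serving base
station. -/
def rateR (p : RISNetwork) (lB lR t r : ℝ) : ℂ :=
  p.cov lB lR r t * ((2 * Real.pi * lB * r * Real.exp (-(Real.pi * r ^ 2 * lB)) : ℝ) : ℂ)

/-- `(∂B_{Υ⁺}(s)/∂λ_BS · λ_BS + B_{Υ⁺}(s) (1 - π r² λ_BS)) 2π r exp(-π r² λ_BS)`. -/
def dRateR_BS (p : RISNetwork) (lB lR t r : ℝ) : ℂ :=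
  (p.dCov_BS lB lR r t * (lB : ℂ) + p.cov lB lR r t * ((1 - Real.pi * r ^ 2 * lB : ℝ) : ℂ))
    * ((2 * Real.pi * r * Real.exp (-(Real.pi * r ^ 2 * lB)) : ℝ) : ℂ)

/-- `∂B_{Υ⁺}(s)/∂λ_RIS · 2π λ_BS r exp(-π r² λ_BS)`. -/
def dRateR_RIS (p : RISNetwork) (lB lR t r : ℝ) : ℂ :=
  p.dCov_RIS lB lR r t * ((2 * Real.pi * lB * r * Real.exp (-(Real.pi * r ^ 2 * lB)) : ℝ) : ℂ)

/-- The mean ergodic rate. -/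
def tau (p : RISNetwork) (lB lR : ℝ) : ℂ :=
  ∫ t in Ioi (0 : ℝ), (∫ r in Ioi p.Rc, p.rateR lB lR t r) * ((1 / (1 + t) : ℝ) : ℂ)

end RISNetwork

end

/-!
The difficulty is that the coverage formula is a principal value, so that a term by term estimate
gives neither decay in `t` nor a domination for the derivatives. Moving the lines of integration
removes it. Write `s = s(r)`. On the closed strip `0 ≤ re z ≤ s` the transform `B` is holomorphic, and
the principal values of `B(s - iu) / u` and `B(-iu) / u` are, up to half residues at `s` and `0`,
integrals over the middle line `re z = s / 2` (`tendsto_pvTrunc_imaginary_axis`, `pv_strip`). The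
half residues cancel the summand `(1 + B(s)) / 2`, and the two kernels add up to a Cauchy density:
the coverage formula equals
`∫ B(s (1/2 + iv)) dv / (2π (1/4 + v²))`,
an absolutely convergent average (`RISNetwork.cov_eq_lineAvg`). The same identity holds for the
derivatives of `B` in the two densities, because they vanish at `z = 0`. Reality follows from
`B(conj z) = conj B(z)`, and everything else is differentiation under the integral sign.

The domination rests on three bounds on the strip, uniform in `r` and `t`.
* The exponent of the reflected signal is bounded (`RISNetwork.norm_expoRIS_le`). This needs the
  convergence condition to hold with a margin uniform in `r`, also as `r → ∞`
  (`RISNetwork.exists_uniform_exponent`).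
* The real part of the exponent of the interference is at least
  `(π / 4) ((t |z| / s) ^ (1 / α) - 1)₊²` (`RISNetwork.le_re_expoBS`), since
  `re (w / (1 + w)) ≥ 1 / 4` for `re w ≥ 0`, `|w| ≥ 1`. Hence `B` decays faster than any power of
  `t |z| / s`.
* The modulus of that exponent grows at most linearly in `t |z| / s`, with a factor `(r + 1) ^ α`
  (`RISNetwork.norm_expoBS_le_rpow`).
So `B` and its derivatives are at most a multiple of `(r + 1) ^ α / (1 + t |z| / s)`
(`RISNetwork.exists_stripBound`). On the middle line `|z| / s ≥ 1 / 2`, which leaves a bound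
`D(r) / (1 + t)` with `D` Gaussian for the integrands over `r`, and `1 / (1 + t)²` for those over `t`.
-/

noncomputable section

/-! ### Principal values on the boundary of a strip -/

/-- Symmetric integrals of a simple fraction along the line `re z = c` tend to `π`: this is the half
residue that a pole on the boundary of a strip contributes. -/
theorem tendsto_integral_cauchy_density {c : ℝ} (hc : 0 < c) :
    Tendsto (fun T : ℝ => ∫ v in (-T)..T, (1 : ℂ) / ((c : ℂ) + v * Complex.I)) atTop
      (𝓝 (Real.pi : ℂ)) := by
  have hne : ∀ v : ℝ, (c : ℂ) + v * Complex.I ≠ 0 := fun v h => by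
    have := congrArg Complex.re h
    simp at this
    exact hc.ne' this
  have hslit : ∀ v : ℝ, (c : ℂ) + v * Complex.I ∈ Complex.slitPlane := fun v => by
    left; simpa using hc
  have hd : ∀ v : ℝ, HasDerivAt
      (fun v : ℝ => -Complex.I * Complex.log ((c : ℂ) + v * Complex.I))
      ((1 : ℂ) / ((c : ℂ) + v * Complex.I)) v := by
    intro v
    have h1 : HasDerivAt (fun v : ℝ => (c : ℂ) + v * Complex.I) Complex.I v := by
      simpa using ((Complex.ofRealCLM.hasDerivAt (x := v)).mul_const Complex.I).const_add (c : ℂ)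
    have h2 := (h1.clog_real (hslit v)).const_mul (-Complex.I)
    exact h2.congr_deriv (by rw [mul_div_assoc', neg_mul, Complex.I_mul_I, neg_neg])
  have hcont : Continuous (fun v : ℝ => (1 : ℂ) / ((c : ℂ) + v * Complex.I)) := by
    apply Continuous.div continuous_const (by fun_prop) hne
  have hval : ∀ T : ℝ, ∫ v in (-T)..T, (1 : ℂ) / ((c : ℂ) + v * Complex.I)
      = ((2 * Real.arctan (T / c) : ℝ) : ℂ) := by
    intro T
    rw [intervalIntegral.integral_eq_sub_of_hasDerivAt (fun v _ => hd v)
      (hcont.intervalIntegrable _ _)]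
    have habs : ‖(c : ℂ) + T * Complex.I‖ = ‖(c : ℂ) + ((-T : ℝ) : ℂ) * Complex.I‖ := by
      rw [Complex.norm_add_mul_I, Complex.norm_add_mul_I]; simp
    have harg : ∀ v : ℝ, Complex.arg ((c : ℂ) + v * Complex.I) = Real.arctan (v / c) := by
      intro v
      rw [← Real.arctan_tan (Complex.neg_pi_div_two_lt_arg_iff.2 (Or.inl (by simpa using hc)))
        (Complex.arg_lt_pi_div_two_iff.2 (Or.inl (by simpa using hc))), Complex.tan_arg]
      simp
    rw [Complex.log, Complex.log, ← habs, harg, harg, neg_div, Real.arctan_neg]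
    simp only [Complex.ofReal_neg, Complex.ofReal_mul, Complex.ofReal_ofNat]
    linear_combination (-2 * (Complex.ofReal (Real.arctan (T / c)))) * Complex.I_mul_I
  simp_rw [hval]
  have h1 : Tendsto (fun T : ℝ => 2 * Real.arctan (T / c)) atTop (𝓝 (2 * (Real.pi / 2))) :=
    (((Real.tendsto_arctan_atTop.mono_right nhdsWithin_le_nhds).comp
      (tendsto_id.atTop_div_const hc))).const_mul 2
  rw [show 2 * (Real.pi / 2) = Real.pi by ring] at h1
  exact (Complex.continuous_ofReal.tendsto _).comp h1

theorem integrable_one_add_abs_mul_abs (ε : ℝ) (hε : 0 < ε) :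
    IntegrableOn (fun v : ℝ => 1 / ((1 + |v|) * |v|)) (Ioi ε) := by
  have h := (integrableOn_Ioi_rpow_of_lt (a := -2) (by norm_num) hε)
  refine Integrable.mono' h (by
    apply Measurable.aestronglyMeasurable; fun_prop) ?_
  filter_upwards [ae_restrict_mem measurableSet_Ioi] with v hv
  have hv : ε < v := hv
  have hv0 : 0 < v := hε.trans hv
  rw [Real.norm_of_nonneg (by positivity), abs_of_pos hv0, Real.rpow_neg hv0.le, Real.rpow_two,
    ← one_div]
  apply one_div_le_one_div_of_le (by positivity)
  nlinarith

theorem integrableOn_div_of_decay {F : ℝ → ℂ} {K : ℝ} (hF : Continuous F)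
    (hK : ∀ v, ‖F v‖ ≤ K / (1 + |v|)) {ε : ℝ} (hε : 0 < ε) :
    IntegrableOn (fun v : ℝ => F v / (v : ℂ)) (Ioi ε) := by
  refine Integrable.mono' ((integrable_one_add_abs_mul_abs ε hε).const_mul K) (by
    apply Measurable.aestronglyMeasurable; have := hF.measurable; fun_prop) ?_
  filter_upwards [ae_restrict_mem measurableSet_Ioi] with v hv
  have hv0 : 0 < v := hε.trans hv
  rw [norm_div, Complex.norm_real, Real.norm_eq_abs]
  have : 0 < |v| := by positivity
  calc ‖F v‖ / |v| ≤ K / (1 + |v|) / |v| := by gcongr; exact hK v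
    _ = K * (1 / ((1 + |v|) * |v|)) := by field_simp

theorem integrableOn_Iio_iff_comp_neg {f : ℝ → ℂ} {ε : ℝ} :
    IntegrableOn f (Iio (-ε)) ↔ IntegrableOn (fun v => f (-v)) (Ioi ε) := by
  have h := (Measure.measurePreserving_neg (volume : Measure ℝ)).integrableOn_comp_preimage
    (f := f) (s := Iio (-ε)) (Homeomorph.neg ℝ).measurableEmbedding
  rw [← h]
  have : (Neg.neg ⁻¹' Iio (-ε) : Set ℝ) = Ioi ε := by ext; simp
  rw [this]; rfl

theorem pvTrunc_eq_integral_Ioi {F : ℝ → ℂ} {ε : ℝ}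
    (h1 : IntegrableOn (fun v : ℝ => F v / (v : ℂ)) (Ioi ε))
    (h2 : IntegrableOn (fun v : ℝ => F (-v) / (v : ℂ)) (Ioi ε)) :
    pvTrunc F ε = ∫ v in Ioi ε, (F v - F (-v)) / (v : ℂ) := by
  have hI : ∫ u in Iio (-ε), F u / (u : ℂ) = ∫ u in Ioi ε, -(F (-u) / (u : ℂ)) := by
    rw [← integral_Iic_eq_integral_Iio, ← integral_comp_neg_Ioi]
    congr 1; ext u; push_cast; ring
  rw [pvTrunc, hI, add_comm, integral_neg, ← sub_eq_add_neg, ← integral_sub h1 h2]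
  congr 1; ext u; ring

/-- Limit of truncated principal values for a kernel `h` that is continuous across the origin. -/
theorem tendsto_integral_Ioi_zero_right {h : ℝ → ℂ} (hc : Continuous h)
    (hi : IntegrableOn h (Ioi 0)) :
    Tendsto (fun ε => ∫ v in Ioi ε, h v) (𝓝[>] 0) (𝓝 (∫ v in Ioi (0 : ℝ), h v)) := by
  have h1 : ∀ ε > 0, ∫ v in Ioi ε, h v = (∫ v in Ioi (0 : ℝ), h v) - ∫ v in (0 : ℝ)..ε, h v := by
    intro ε hε
    rw [intervalIntegral.integral_of_le hε.le, ← Ioc_union_Ioi_eq_Ioi (le_of_lt hε),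
      setIntegral_union (by simp) measurableSet_Ioi
      (hi.mono_set Ioc_subset_Ioi_self) (hi.mono_set (Ioi_subset_Ioi (le_of_lt hε)))]
    ring
  have h2 : Tendsto (fun ε => (∫ v in Ioi (0 : ℝ), h v) - ∫ v in (0 : ℝ)..ε, h v) (𝓝[>] 0)
      (𝓝 ((∫ v in Ioi (0 : ℝ), h v) - ∫ v in (0 : ℝ)..0, h v)) := by
    apply Tendsto.mono_left _ nhdsWithin_le_nhds
    exact ((continuous_const.sub (intervalIntegral.continuous_primitive
      (fun a b => hc.intervalIntegrable a b) 0))).tendsto 0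
  simp only [intervalIntegral.integral_same, sub_zero] at h2
  refine h2.congr' ?_
  filter_upwards [self_mem_nhdsWithin] with ε hε
  exact (h1 ε hε).symm


/-- For a function holomorphic near the strip `0 ≤ re z ≤ c` and decaying along it, the principal
value along the imaginary axis is the integral along `re z = c` minus half the residue at `0`.
Cauchy's theorem is applied to the difference quotient `dslope f 0`, which has no pole. -/
theorem tendsto_pvTrunc_imaginary_axis {f : ℂ → ℂ} {c K : ℝ} (hc : 0 < c)
    (hf : ∀ z : ℂ, 0 ≤ z.re → z.re ≤ c → DifferentiableAt ℂ f z)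
    (hK : ∀ z : ℂ, 0 ≤ z.re → z.re ≤ c → ‖f z‖ ≤ K / (1 + |z.im|)) :
    Integrable (fun v : ℝ => f (c + v * Complex.I) / (c + v * Complex.I)) ∧
    (∀ ε : ℝ, 0 < ε → IntegrableOn (fun v : ℝ => f (v * Complex.I) / (v : ℂ)) (Ioi ε) ∧
      IntegrableOn (fun v : ℝ => f (v * Complex.I) / (v : ℂ)) (Iio (-ε))) ∧
    Tendsto (pvTrunc (fun v : ℝ => f (v * Complex.I))) (𝓝[>] 0)
      (𝓝 (Complex.I * ((∫ v : ℝ, f (c + v * Complex.I) / (c + v * Complex.I))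
        - Real.pi * f 0))) := by
  have hK0 : 0 ≤ K := by
    have := (norm_nonneg _).trans (hK 0 (by simp) (by simpa using hc.le))
    simpa using this
  have hfi : Continuous (fun v : ℝ => f (v * Complex.I)) := by
    rw [continuous_iff_continuousAt]; intro v
    exact ContinuousAt.comp (f := fun v : ℝ => (v : ℂ) * Complex.I)
      (hf _ (by simp) (by simpa using hc.le)).continuousAt (by fun_prop)
  have hKi : ∀ v : ℝ, ‖f (v * Complex.I)‖ ≤ K / (1 + |v|) := fun v => by
    simpa using hK (v * Complex.I) (by simp) (by simpa using hc.le)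
  have hfi' : Continuous (fun v : ℝ => f ((-v : ℝ) * Complex.I)) := hfi.comp continuous_neg
  have hKi' : ∀ v : ℝ, ‖f ((-v : ℝ) * Complex.I)‖ ≤ K / (1 + |v|) := fun v => by
    simpa using hKi (-v)
  have hA : ∀ ε : ℝ, 0 < ε → IntegrableOn (fun v : ℝ => f (v * Complex.I) / (v : ℂ)) (Ioi ε) :=
    fun ε hε => integrableOn_div_of_decay hfi hKi hε
  have hA' : ∀ ε : ℝ, 0 < ε →
      IntegrableOn (fun v : ℝ => f ((-v : ℝ) * Complex.I) / (v : ℂ)) (Ioi ε) :=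
    fun ε hε => integrableOn_div_of_decay hfi' hKi' hε
  have hcne : ∀ v : ℝ, (c : ℂ) + v * Complex.I ≠ 0 := fun v h => by
    have := congrArg Complex.re h
    simp at this
    exact hc.ne' this
  have hfc : Continuous (fun v : ℝ => f (c + v * Complex.I)) := by
    rw [continuous_iff_continuousAt]; intro v
    exact ContinuousAt.comp (f := fun v : ℝ => (c : ℂ) + (v : ℂ) * Complex.I)
      (hf _ (by simpa using hc.le) (by simp)).continuousAt (by fun_prop)
  have hfcd : Continuous (fun v : ℝ => f (c + v * Complex.I) / (c + v * Complex.I)) :=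
    hfc.div (by fun_prop) hcne
  have hM : Integrable (fun v : ℝ => f (c + v * Complex.I) / (c + v * Complex.I)) := by
    refine Integrable.mono' ((integrable_inv_one_add_sq).const_mul (K * (1 + 1 / c)))
      hfcd.aestronglyMeasurable (Eventually.of_forall fun v => ?_)
    have h1 := hK (c + v * Complex.I) (by simpa using hc.le) (by simp)
    simp only [Complex.add_im, Complex.ofReal_im, Complex.mul_im, Complex.ofReal_re, Complex.I_im,
      Complex.I_re, mul_one, mul_zero, zero_add, add_zero] at h1
    have h2 : |v| ≤ ‖(c : ℂ) + v * Complex.I‖ := by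
      simpa using Complex.abs_im_le_norm ((c : ℂ) + v * Complex.I)
    have h3 : c ≤ ‖(c : ℂ) + v * Complex.I‖ := by
      simpa [abs_of_pos hc] using Complex.abs_re_le_norm ((c : ℂ) + v * Complex.I)
    have h4 : 0 < ‖(c : ℂ) + v * Complex.I‖ := hc.trans_le h3
    have h5 : 1 + |v| ≤ (1 + 1 / c) * ‖(c : ℂ) + v * Complex.I‖ := by
      have : 1 ≤ 1 / c * ‖(c : ℂ) + v * Complex.I‖ := by
        rw [one_div, inv_mul_eq_div, le_div_iff₀ hc]; linarith
      linarith
    have h6 : 1 + v ^ 2 ≤ (1 + |v|) * (1 + |v|) := by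
      nlinarith [abs_nonneg v, sq_abs v]
    rw [norm_div, div_le_iff₀ h4]
    refine h1.trans ?_
    rw [div_le_iff₀ (by positivity), mul_assoc, mul_assoc, mul_assoc]
    have h7 : 1 ≤ (1 + 1 / c) * ((1 + v ^ 2)⁻¹ * (‖(c : ℂ) + v * Complex.I‖ * (1 + |v|))) := by
      have : (1 + v ^ 2)⁻¹ * (1 + v ^ 2) = 1 := inv_mul_cancel₀ (by positivity)
      calc (1 : ℝ) = (1 + v ^ 2)⁻¹ * (1 + v ^ 2) := this.symm
        _ ≤ (1 + v ^ 2)⁻¹ * (((1 + 1 / c) * ‖(c : ℂ) + v * Complex.I‖) * (1 + |v|)) := by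
          gcongr
          exact h6.trans (by gcongr)
        _ = _ := by ring
    nlinarith
  set q := dslope f 0 with hq
  have hqne : ∀ z : ℂ, z ≠ 0 → q z = (f z - f 0) / z := fun z hz => by
    rw [hq, dslope_of_ne _ hz, slope_def_field, sub_zero]
  have hqc : ∀ z : ℂ, 0 ≤ z.re → z.re ≤ c → ContinuousAt q z := by
    intro z h1 h2
    by_cases hz : z = 0
    · subst hz; exact continuousAt_dslope_same.2 (hf 0 h1 h2)
    · exact (continuousAt_dslope_of_ne hz).2 (hf z h1 h2).continuousAt
  have hqi : Continuous (fun v : ℝ => q (v * Complex.I)) := by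
    rw [continuous_iff_continuousAt]; intro v
    exact ContinuousAt.comp (f := fun v : ℝ => (v : ℂ) * Complex.I)
      (hqc _ (by simp) (by simpa using hc.le)) (by fun_prop)
  set h : ℝ → ℂ := fun v => Complex.I * (q (v * Complex.I) + q ((-v : ℝ) * Complex.I)) with hh
  have hhc : Continuous h := by
    have : Continuous (fun v : ℝ => q ((-v : ℝ) * Complex.I)) := hqi.comp continuous_neg
    exact continuous_const.mul (hqi.add this)
  -- in the sum over `±v` the value `f 0` cancels, so `h` is the integrand of the truncations
  have hhne : ∀ v : ℝ, v ≠ 0 →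
      h v = (f (v * Complex.I) - f ((-v : ℝ) * Complex.I)) / (v : ℂ) := by
    intro v hv
    have hv' : (v : ℂ) ≠ 0 := by exact_mod_cast hv
    simp only [hh]
    rw [hqne _ (by simp [hv]), hqne _ (by simp [hv])]
    push_cast
    field_simp
    ring
  have hhi1 : ∀ ε > 0, IntegrableOn h (Ioi ε) := by
    intro ε hε
    refine IntegrableOn.congr_fun ((hA ε hε).sub (hA' ε hε)) ?_ measurableSet_Ioi
    intro v hv
    rw [hhne v (hε.trans hv).ne']
    simp [sub_div]
  have hhi : IntegrableOn h (Ioi 0) := by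
    rw [← Ioc_union_Ioi_eq_Ioi (zero_le_one' ℝ)]
    exact ((hhc.integrableOn_Icc (a := 0) (b := 1)).mono_set Ioc_subset_Icc_self).union
      (hhi1 1 one_pos)
  refine ⟨hM, fun ε hε => ⟨hA ε hε, ?_⟩, ?_⟩
  · rw [integrableOn_Iio_iff_comp_neg]
    refine (hA' ε hε).neg.congr_fun ?_ measurableSet_Ioi
    intro v _
    simp [div_neg]
  have hlim : ∫ v in Ioi (0 : ℝ), h v
      = Complex.I * ((∫ v : ℝ, f (c + v * Complex.I) / (c + v * Complex.I)) - Real.pi * f 0) := by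
    have hT1 : Tendsto (fun T : ℝ => ∫ v in (0 : ℝ)..T, h v) atTop
        (𝓝 (∫ v in Ioi (0 : ℝ), h v)) :=
      intervalIntegral_tendsto_integral_Ioi 0 hhi tendsto_id
    have hT2 : Tendsto (fun T : ℝ => Complex.I * ((∫ v in (-T)..T,
        f (c + v * Complex.I) / (c + v * Complex.I))
        - (∫ v in (-T)..T, (1 : ℂ) / ((c : ℂ) + v * Complex.I)) * f 0)) atTop
        (𝓝 (Complex.I * ((∫ v : ℝ, f (c + v * Complex.I) / (c + v * Complex.I))
          - Real.pi * f 0))) :=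
      ((intervalIntegral_tendsto_integral hM tendsto_neg_atTop_atBot tendsto_id).sub
        ((tendsto_integral_cauchy_density hc).mul_const _)).const_mul _
    -- Cauchy's theorem on the rectangle `[0, c] × [-T, T]`
    have hrect : ∀ T : ℝ, 0 < T → (∫ v in (0 : ℝ)..T, h v) =
        ((∫ x in (0 : ℝ)..c, q (x + (-T : ℝ) * Complex.I))
          - ∫ x in (0 : ℝ)..c, q (x + T * Complex.I)) +
        Complex.I * ((∫ v in (-T)..T, f (c + v * Complex.I) / (c + v * Complex.I))
        - (∫ v in (-T)..T, (1 : ℂ) / ((c : ℂ) + v * Complex.I)) * f 0) := by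
      intro T hT
      have hR := Complex.integral_boundary_rect_eq_zero_of_differentiable_on_off_countable q
        ⟨0, -T⟩ ⟨c, T⟩ {0} (countable_singleton 0)
        (fun z hz => by
          rw [Complex.mem_reProdIm, uIcc_of_le hc.le] at hz
          exact (hqc z hz.1.1 hz.1.2).continuousWithinAt)
        (fun z hz => by
          have h1 := (Complex.mem_reProdIm.1 hz.1).1
          simp only [min_eq_left hc.le, max_eq_right hc.le] at h1
          exact (differentiableAt_dslope_of_ne (by simpa using hz.2)).2
            (hf z h1.1.le h1.2.le))
      simp only [smul_eq_mul, Complex.ofReal_zero, zero_add] at hR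
      have e1 : ∫ v in (-T)..T, q (c + v * Complex.I) =
          (∫ v in (-T)..T, f (c + v * Complex.I) / (c + v * Complex.I))
          - (∫ v in (-T)..T, (1 : ℂ) / ((c : ℂ) + v * Complex.I)) * f 0 := by
        rw [← intervalIntegral.integral_mul_const, ← intervalIntegral.integral_sub]
        · congr 1; ext v; rw [hqne _ (hcne v)]; ring
        · exact hfcd.intervalIntegrable _ _
        · apply Continuous.intervalIntegrable
          exact (continuous_const.div (by fun_prop) hcne).mul continuous_const
      have e2 : Complex.I * ∫ v in (-T)..T, q (v * Complex.I) = ∫ v in (0 : ℝ)..T, h v := by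
        have e3 : ∫ v in (-T)..0, q (v * Complex.I) =
            ∫ v in (0 : ℝ)..T, q ((-v : ℝ) * Complex.I) := by
          rw [intervalIntegral.integral_comp_neg (fun v : ℝ => q (v * Complex.I)), neg_zero]
        have hqi' : Continuous (fun v : ℝ => q ((-v : ℝ) * Complex.I)) := hqi.comp continuous_neg
        rw [← intervalIntegral.integral_add_adjacent_intervals (b := 0)
          (hqi.intervalIntegrable _ _) (hqi.intervalIntegrable _ _), e3, add_comm,
          ← intervalIntegral.integral_add (hqi.intervalIntegrable _ _)
            (hqi'.intervalIntegrable _ _), ← intervalIntegral.integral_const_mul]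
      rw [e2, e1] at hR
      linear_combination -hR
    -- the horizontal sides of the rectangle contribute nothing in the limit
    have hhor : ∀ σ : ℝ, |σ| = 1 →
        Tendsto (fun T : ℝ => ∫ x in (0 : ℝ)..c, q (x + ((σ * T : ℝ) : ℂ) * Complex.I)) atTop
          (𝓝 0) := by
      intro σ hσ
      have hz : Tendsto (fun T : ℝ => (K + ‖f 0‖) / T * |c - 0|) atTop (𝓝 0) := by
        simpa using (tendsto_const_nhds.div_atTop tendsto_id).mul_const |c - 0|
      refine squeeze_zero_norm' ?_ hz
      filter_upwards [eventually_gt_atTop 0] with T hT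
      apply intervalIntegral.norm_integral_le_of_norm_le_const
      intro x hx
      rw [uIoc_of_le hc.le] at hx
      have him : ((x : ℂ) + ((σ * T : ℝ) : ℂ) * Complex.I).im = σ * T := by simp
      have hre : ((x : ℂ) + ((σ * T : ℝ) : ℂ) * Complex.I).re = x := by simp
      have habs : |σ * T| = T := by rw [abs_mul, hσ, one_mul, abs_of_pos hT]
      have hn : T ≤ ‖(x : ℂ) + ((σ * T : ℝ) : ℂ) * Complex.I‖ := by
        have := Complex.abs_im_le_norm ((x : ℂ) + ((σ * T : ℝ) : ℂ) * Complex.I)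
        rwa [him, habs] at this
      have hne : (x : ℂ) + ((σ * T : ℝ) : ℂ) * Complex.I ≠ 0 := norm_pos_iff.1 (hT.trans_le hn)
      rw [hqne _ hne, norm_div]
      have hfb := hK ((x : ℂ) + ((σ * T : ℝ) : ℂ) * Complex.I) (by rw [hre]; exact hx.1.le)
        (by rw [hre]; exact hx.2)
      rw [him, habs] at hfb
      have hfb' : K / (1 + T) ≤ K := div_le_self hK0 (by linarith)
      have hnum : ‖f ((x : ℂ) + ((σ * T : ℝ) : ℂ) * Complex.I) - f 0‖ ≤ K + ‖f 0‖ :=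
        (norm_sub_le _ _).trans (by linarith)
      gcongr
    have hsum := ((hhor (-1) (by simp)).sub (hhor 1 (by simp))).add hT2
    simp only [neg_mul, one_mul, sub_zero, zero_add] at hsum
    refine tendsto_nhds_unique hT1 (hsum.congr' ?_)
    filter_upwards [eventually_gt_atTop 0] with T hT
    exact (hrect T hT).symm
  rw [← hlim]
  refine (tendsto_integral_Ioi_zero_right hhc hhi).congr' ?_
  filter_upwards [self_mem_nhdsWithin] with ε hε
  have hε : 0 < ε := hε
  rw [pvTrunc_eq_integral_Ioi (hA ε hε) (hA' ε hε)]
  refine setIntegral_congr_fun measurableSet_Ioi fun v hv => ?_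
  exact hhne v (hε.trans hv).ne'


theorem pvTrunc_comp_neg (F : ℝ → ℂ) (ε : ℝ) :
    pvTrunc (fun u => F (-u)) ε = -pvTrunc F ε := by
  have h1 : ∀ G : ℝ → ℂ, ∫ u in Iio (-ε), G u = ∫ u in Ioi ε, G (-u) := fun G => by
    rw [← integral_Iic_eq_integral_Iio, ← integral_comp_neg_Ioi]
  simp only [pvTrunc, h1, ← integral_neg, neg_add]
  rw [add_comm]
  congr 1 <;> (congr 1; ext u; push_cast; simp [div_neg])

theorem cauchy_weights_add {s : ℝ} (hs : 0 < s) (v : ℝ) (a : ℂ) :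
    a / (((s / 2 : ℝ) : ℂ) + v * Complex.I) + a / (((s / 2 : ℝ) : ℂ) + (-v : ℝ) * Complex.I)
      = a * ((s / ((s / 2) ^ 2 + v ^ 2) : ℝ) : ℂ) := by
  have h0 : ((s / 2) ^ 2 + v ^ 2) ≠ 0 := by positivity
  have h0' : (((s / 2) ^ 2 + v ^ 2 : ℝ) : ℂ) ≠ 0 := by exact_mod_cast h0
  have h3 : (((s / 2 : ℝ) : ℂ) + v * Complex.I) * (((s / 2 : ℝ) : ℂ) + (-v : ℝ) * Complex.I)
      = (((s / 2) ^ 2 + v ^ 2 : ℝ) : ℂ) := by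
    push_cast
    linear_combination (-(v : ℂ) ^ 2) * Complex.I_mul_I
  have h1 : ((s / 2 : ℝ) : ℂ) + v * Complex.I ≠ 0 := fun h => h0' (by rw [← h3, h, zero_mul])
  have h2 : ((s / 2 : ℝ) : ℂ) + (-v : ℝ) * Complex.I ≠ 0 := fun h => h0' (by rw [← h3, h, mul_zero])
  rw [div_add_div _ _ h1 h2, h3, div_eq_iff h0', mul_assoc, ← Complex.ofReal_mul,
    div_mul_cancel₀ _ h0]
  push_cast
  ring

/-- The weight `1 / (2π (1/4 + v²))` produced by moving both principal values to the middle line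
of the strip. -/
def lineWeight (v : ℝ) : ℝ := 1 / (2 * Real.pi * (1 / 4 + v ^ 2))

/-- Moving the two principal values over the boundary lines of the strip `0 ≤ re z ≤ s` to its
middle line turns them into one absolutely convergent integral. -/
theorem pv_strip {F : ℂ → ℂ} {s K : ℝ} (hs : 0 < s)
    (hf : ∀ z : ℂ, 0 ≤ z.re → z.re ≤ s → DifferentiableAt ℂ F z)
    (hK : ∀ z : ℂ, 0 ≤ z.re → z.re ≤ s → ‖F z‖ ≤ K / (1 + |z.im|)) :
    PVConverges (pvNum F s) ∧
    pvIntegral (pvNum F s) = Complex.I * (2 * Real.pi *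
      (∫ v : ℝ, F (s * (1 / 2 + v * Complex.I)) * (lineWeight v : ℂ)) - Real.pi * (F 0 + F s)) := by
  have hc : 0 < s / 2 := by positivity
  have h0 := tendsto_pvTrunc_imaginary_axis (f := F) (c := s / 2) (K := K) hc
    (fun z h1 h2 => hf z h1 (by linarith)) (fun z h1 h2 => hK z h1 (by linarith))
  have h1 := tendsto_pvTrunc_imaginary_axis (f := fun z => F (s - z)) (c := s / 2) (K := K) hc
    (fun z h1 h2 => by
      have := hf (s - z) (by simp; linarith) (by simp; linarith)
      exact DifferentiableAt.comp (f := fun z : ℂ => (s : ℂ) - z) z this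
        (differentiableAt_id.const_sub (s : ℂ)))
    (fun z h1 h2 => by
      have := hK (s - z) (by simp; linarith) (by simp; linarith)
      simpa using this)
  obtain ⟨i0, a0, t0⟩ := h0
  obtain ⟨i1, a1, t1⟩ := h1
  have hnum : ∀ u : ℝ, pvNum F s u = F (s - u * Complex.I) - F ((-u : ℝ) * Complex.I) := by
    intro u; simp only [pvNum]; push_cast; ring_nf
  have hdiv : (fun u : ℝ => pvNum F s u / (u : ℂ)) = fun u : ℝ =>
      F (s - u * Complex.I) / (u : ℂ) - F ((-u : ℝ) * Complex.I) / (u : ℂ) := by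
    ext u; rw [hnum, sub_div]
  have b0 : ∀ ε : ℝ, 0 < ε →
      IntegrableOn (fun u : ℝ => F ((-u : ℝ) * Complex.I) / (u : ℂ)) (Iio (-ε)) ∧
      IntegrableOn (fun u : ℝ => F ((-u : ℝ) * Complex.I) / (u : ℂ)) (Ioi ε) := by
    intro ε hε
    constructor
    · rw [integrableOn_Iio_iff_comp_neg]
      refine (a0 ε hε).1.neg.congr_fun ?_ measurableSet_Ioi
      intro v _
      simp [div_neg]
    · have := (a0 ε hε).2
      rw [integrableOn_Iio_iff_comp_neg] at this
      refine this.neg.congr_fun ?_ measurableSet_Ioi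
      intro v _
      simp [div_neg]
  have htr : ∀ ε : ℝ, 0 < ε → pvTrunc (pvNum F s) ε =
      pvTrunc (fun v : ℝ => F (s - v * Complex.I)) ε + pvTrunc (fun v : ℝ => F (v * Complex.I)) ε := by
    intro ε hε
    have e := pvTrunc_comp_neg (fun v : ℝ => F (v * Complex.I)) ε
    rw [← neg_neg (pvTrunc (fun v : ℝ => F (v * Complex.I)) ε), ← e, ← sub_eq_add_neg]
    have e1 : ∫ u in Iio (-ε), pvNum F s u / (u : ℂ) =
        (∫ u in Iio (-ε), F (s - u * Complex.I) / (u : ℂ))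
          - ∫ u in Iio (-ε), F ((-u : ℝ) * Complex.I) / (u : ℂ) := by
      rw [hdiv]; exact integral_sub (a1 ε hε).2 (b0 ε hε).1
    have e2 : ∫ u in Ioi ε, pvNum F s u / (u : ℂ) =
        (∫ u in Ioi ε, F (s - u * Complex.I) / (u : ℂ))
          - ∫ u in Ioi ε, F ((-u : ℝ) * Complex.I) / (u : ℂ) := by
      rw [hdiv]; exact integral_sub (a1 ε hε).1 (b0 ε hε).2
    simp only [pvTrunc]
    rw [e1, e2]
    ring
  have hlim := (t1.add t0).congr' (f₂ := pvTrunc (pvNum F s)) (by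
    filter_upwards [self_mem_nhdsWithin] with ε hε
    exact (htr ε hε).symm)
  refine ⟨⟨fun ε hε => ?_, ⟨_, hlim⟩⟩, ?_⟩
  · rw [hdiv]
    exact ⟨(a1 ε hε).2.sub (b0 ε hε).1, (a1 ε hε).1.sub (b0 ε hε).2⟩
  rw [pvIntegral, hlim.limUnder_eq]
  have i1' : Integrable (fun v : ℝ => F (((s / 2 : ℝ) : ℂ) + v * Complex.I)
      / (((s / 2 : ℝ) : ℂ) + (-v : ℝ) * Complex.I)) := by
    refine i1.comp_neg.congr (Eventually.of_forall fun v => ?_)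
    have : (s : ℂ) - (((s / 2 : ℝ) : ℂ) + (-v : ℝ) * Complex.I)
      = ((s / 2 : ℝ) : ℂ) + v * Complex.I := by push_cast; ring
    simp only [this]
  have hswap : ∫ v : ℝ, F (s - (((s / 2 : ℝ) : ℂ) + v * Complex.I))
        / (((s / 2 : ℝ) : ℂ) + v * Complex.I)
      = ∫ v : ℝ, F (((s / 2 : ℝ) : ℂ) + v * Complex.I)
        / (((s / 2 : ℝ) : ℂ) + (-v : ℝ) * Complex.I) := by
    rw [← integral_neg_eq_self]
    congr 1; ext v
    have : (s : ℂ) - (((s / 2 : ℝ) : ℂ) + (-v : ℝ) * Complex.I)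
      = ((s / 2 : ℝ) : ℂ) + v * Complex.I := by push_cast; ring
    simp only [this]
  have hsum : (∫ v : ℝ, F (((s / 2 : ℝ) : ℂ) + v * Complex.I) / (((s / 2 : ℝ) : ℂ) + v * Complex.I))
      + (∫ v : ℝ, F (((s / 2 : ℝ) : ℂ) + v * Complex.I)
        / (((s / 2 : ℝ) : ℂ) + (-v : ℝ) * Complex.I))
      = 2 * Real.pi * ∫ v : ℝ, F (s * (1 / 2 + v * Complex.I)) * (lineWeight v : ℂ) := by
    rw [← integral_add i0 i1', ← integral_const_mul]
    simp_rw [cauchy_weights_add hs]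
    have := Measure.integral_comp_mul_left (fun v : ℝ => F (((s / 2 : ℝ) : ℂ) + v * Complex.I)
      * ((s / ((s / 2) ^ 2 + v ^ 2) : ℝ) : ℂ)) s
    have e : (∫ v : ℝ, F (((s / 2 : ℝ) : ℂ) + v * Complex.I)
      * ((s / ((s / 2) ^ 2 + v ^ 2) : ℝ) : ℂ)) = (s : ℂ) * ∫ v : ℝ,
        F (((s / 2 : ℝ) : ℂ) + (s * v : ℝ) * Complex.I)
          * ((s / ((s / 2) ^ 2 + (s * v) ^ 2) : ℝ) : ℂ) := by
      rw [this, abs_of_pos (inv_pos.2 hs), Complex.real_smul, ← mul_assoc, ← Complex.ofReal_mul,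
        mul_inv_cancel₀ hs.ne', Complex.ofReal_one, one_mul]
    rw [e, ← integral_const_mul]
    congr 1; ext v
    have e1 : ((s / 2 : ℝ) : ℂ) + (s * v : ℝ) * Complex.I = s * (1 / 2 + v * Complex.I) := by
      push_cast; ring
    have e2 : (s : ℂ) * ((s / ((s / 2) ^ 2 + (s * v) ^ 2) : ℝ) : ℂ)
        = 2 * Real.pi * (lineWeight v : ℂ) := by
      rw [lineWeight]
      have hpi := Real.pi_pos
      have : s * (s / ((s / 2) ^ 2 + (s * v) ^ 2)) = 2 * Real.pi * (1 / (2 * Real.pi * (1 / 4 + v ^ 2))) := by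
        have h1 : (1 / 4 + v ^ 2) ≠ 0 := by positivity
        have h2 : (s / 2) ^ 2 + (s * v) ^ 2 = s ^ 2 * (1 / 4 + v ^ 2) := by ring
        rw [h2]
        field_simp
      exact_mod_cast this
    rw [e1]
    linear_combination (F (s * (1 / 2 + v * Complex.I))) * e2
  rw [hswap, sub_zero]
  linear_combination Complex.I * hsum

/-! ### Laplace transforms of the fading powers -/

theorem RISNetwork.LD_eq {w : ℂ} (hw : -1 < w.re) : RISNetwork.LD w = 1 / (1 + w) := by
  have h1 : RISNetwork.LD w = ∫ x in Ioi (0 : ℝ), Complex.exp (-(1 + w) * x) := by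
    rw [RISNetwork.LD, complexMGF, expMeasure, gammaMeasure,
      integral_withDensity_eq_integral_toReal_smul 
        (show Measurable (gammaPDF 1 1) from (measurable_gammaPDFReal 1 1).ennreal_ofReal)
        (Eventually.of_forall fun x => by simp [gammaPDF]),
      ← integral_indicator measurableSet_Ioi]
    apply integral_congr_ae
    filter_upwards [Measure.ae_ne volume (0 : ℝ)] with x hx
    rcases lt_or_gt_of_ne hx with h | h
    · rw [gammaPDF_of_neg h, indicator_of_notMem (by simpa using h.le)]
      simp
    · rw [gammaPDF_of_nonneg h.le, indicator_of_mem (by simpa using h)]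
      simp only [Real.one_rpow, Real.Gamma_one, div_one, sub_self, Real.rpow_zero, mul_one, one_mul]
      rw [ENNReal.toReal_ofReal (Real.exp_pos _).le, Complex.real_smul, Complex.ofReal_exp,
        ← Complex.exp_add]
      congr 1
      simp only [id, Complex.ofReal_neg]
      ring
  have h2 : 1 + w ≠ 0 := fun h => by
    have := congrArg Complex.re h
    simp at this
    linarith
  rw [h1, integral_exp_mul_complex_Ioi (by simp; linarith)]
  simp only [Complex.ofReal_zero, mul_zero, Complex.exp_zero]
  rw [div_neg, neg_div, neg_neg]

theorem Complex.ofReal_pos_mul_cpow {a : ℝ} (ha : 0 < a) (z w : ℂ) :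
    ((a : ℂ) * z) ^ w = (a : ℂ) ^ w * z ^ w := by
  rcases eq_or_ne z 0 with rfl | hz
  · rcases eq_or_ne w 0 with rfl | hw
    · simp
    · simp [Complex.zero_cpow hw]
  · have ha' : (a : ℂ) ≠ 0 := by exact_mod_cast ha.ne'
    rw [Complex.cpow_def_of_ne_zero (mul_ne_zero ha' hz), Complex.cpow_def_of_ne_zero ha',
      Complex.cpow_def_of_ne_zero hz, Complex.log_ofReal_mul ha hz, ← Complex.ofReal_log ha.le,
      ← Complex.exp_add, add_mul]

section GaussianSquare

variable {μ : ℝ} {V : NNReal}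

/-- Completing the square: the integrand of the Laplace transform of the square of a Gaussian. -/
theorem gaussianPDFReal_smul_cexp_sq (hV : V ≠ 0) (w : ℂ) (x : ℝ) :
    gaussianPDFReal μ V x • Complex.exp (-w * ((x ^ 2 : ℝ) : ℂ)) =
      ((Real.sqrt (2 * Real.pi * V))⁻¹ : ℝ) *
        Complex.exp (-(w + 1 / (2 * V)) * (x : ℂ) ^ 2 + (μ / V : ℂ) * x + -(μ : ℂ) ^ 2 / (2 * V)) := by
  have hV' : (V : ℂ) ≠ 0 := by exact_mod_cast hV
  rw [gaussianPDFReal, Complex.real_smul, Complex.ofReal_mul, mul_assoc, Complex.ofReal_exp,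
    ← Complex.exp_add]
  congr 2
  push_cast
  field_simp
  ring

theorem re_gaussian_quadratic (hV : V ≠ 0) {w : ℂ} (hw : -1 < 2 * (V : ℝ) * w.re) :
    (-(w + 1 / (2 * V)) : ℂ).re < 0 := by
  have hV0 : (0 : ℝ) < V := by positivity
  have h1 : ((1 : ℂ) / (2 * V)).re = 1 / (2 * V) := by
    have : ((1 : ℂ) / (2 * V)) = ((1 / (2 * V) : ℝ) : ℂ) := by push_cast; rfl
    rw [this, Complex.ofReal_re]
  rw [Complex.neg_re, Complex.add_re, h1, neg_lt_zero]
  have : 0 < (1 + 2 * V * w.re) / (2 * V) := by apply div_pos <;> linarith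
  have e : (1 + 2 * V * w.re) / (2 * V) = w.re + 1 / (2 * V) := by field_simp; ring
  linarith

theorem integrable_cexp_sq_gaussianReal {w : ℂ} (hw : -1 < 2 * (V : ℝ) * w.re) :
    Integrable (fun x : ℝ => Complex.exp (-w * ((x ^ 2 : ℝ) : ℂ))) (gaussianReal μ V) := by
  by_cases hV : V = 0
  · rw [hV, gaussianReal_zero_var]
    exact integrable_dirac (by simp [enorm_lt_top])
  rw [gaussianReal_of_var_ne_zero _ hV,
    integrable_withDensity_iff_integrable_smul' (measurable_gaussianPDF _ _)
      (Eventually.of_forall fun x => by simp [gaussianPDF])]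
  simp only [toReal_gaussianPDF, gaussianPDFReal_smul_cexp_sq hV]
  exact (integrable_cexp_quadratic' (re_gaussian_quadratic hV hw) _ _).const_mul _

/-- Laplace transform of the square of a Gaussian variable (a noncentral chi-square law). -/
theorem complexMGF_sq_gaussianReal {w : ℂ} (hw : -1 < 2 * (V : ℝ) * w.re) :
    complexMGF (fun x : ℝ => x ^ 2) (gaussianReal μ V) (-w) =
      Complex.exp (-(w * (μ : ℂ) ^ 2) / (1 + 2 * w * (V : ℂ))) /
        (1 + 2 * w * (V : ℂ)) ^ (1 / 2 : ℂ) := by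
  by_cases hV : V = 0
  · simp [complexMGF, hV]
  have hV0 : (0 : ℝ) < V := by positivity
  have hV' : (V : ℂ) ≠ 0 := by exact_mod_cast hV
  have hre : 0 < (1 + 2 * w * (V : ℂ)).re := by
    simp only [Complex.add_re, Complex.one_re, Complex.mul_re, Complex.re_ofNat, Complex.im_ofNat,
      zero_mul, sub_zero]
    simp
    linarith
  have hD : 1 + 2 * w * (V : ℂ) ≠ 0 := fun h => by rw [h] at hre; simp at hre
  rw [complexMGF, integral_gaussianReal_eq_integral_smul hV]
  simp only [gaussianPDFReal_smul_cexp_sq hV]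
  rw [integral_const_mul, integral_cexp_quadratic (re_gaussian_quadratic hV hw)]
  have e1 : (Real.pi : ℂ) / -(-(w + 1 / (2 * V))) =
      ((2 * Real.pi * V : ℝ) : ℂ) * (1 + 2 * w * (V : ℂ))⁻¹ := by
    have h2 : w + 1 / (2 * V) = (1 + 2 * w * V) / (2 * V) := by field_simp; ring
    rw [neg_neg, h2]
    push_cast
    field_simp
  have e2 : ((2 * Real.pi * V : ℝ) : ℂ) ^ (1 / 2 : ℂ) = (Real.sqrt (2 * Real.pi * V) : ℝ) := by
    rw [Real.sqrt_eq_rpow, Complex.ofReal_cpow (by positivity)]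
    norm_num
  have harg : (1 + 2 * w * (V : ℂ)).arg ≠ Real.pi := by
    have := (Complex.arg_lt_pi_div_two_iff (z := 1 + 2 * w * (V : ℂ))).2 (Or.inl hre)
    have := Real.pi_pos
    intro h; linarith
  have e3 : -(μ : ℂ) ^ 2 / (2 * V) - (μ / V : ℂ) ^ 2 / (4 * -(w + 1 / (2 * V))) =
      -(w * (μ : ℂ) ^ 2) / (1 + 2 * w * (V : ℂ)) := by
    have h2 : w + 1 / (2 * V) = (1 + 2 * w * V) / (2 * V) := by field_simp; ring
    rw [h2]
    generalize hDg : 1 + 2 * w * (V : ℂ) = D at hD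
    field_simp
    rw [← hDg]
    ring
  have hs : ((Real.sqrt (2 * Real.pi * V))⁻¹ : ℝ) * ((Real.sqrt (2 * Real.pi * V) : ℝ) : ℂ) = 1 := by
    rw [← Complex.ofReal_mul, inv_mul_cancel₀ (by positivity), Complex.ofReal_one]
  rw [e1, e3, Complex.ofReal_pos_mul_cpow (by positivity), e2, Complex.inv_cpow _ _ harg,
    ← mul_assoc, ← mul_assoc, hs, one_mul]
  exact inv_mul_eq_div _ _

theorem integrable_exp_sq_gaussianReal {c : ℝ} (hc : 2 * (V : ℝ) * c < 1) :
    Integrable (fun x : ℝ => Real.exp (c * x ^ 2)) (gaussianReal μ V) := by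
  have h := (integrable_cexp_sq_gaussianReal (μ := μ) (V := V) (w := ((-c : ℝ) : ℂ))
    (by rw [Complex.ofReal_re]; linarith)).norm
  refine h.congr (Eventually.of_forall fun x => ?_)
  simp only [Complex.norm_exp]
  congr 1
  rw [← Complex.ofReal_neg, ← Complex.ofReal_mul, Complex.ofReal_re]
  ring

theorem mem_interior_integrableExpSet_sq_gaussianReal {c : ℝ} (hc : 2 * (V : ℝ) * c < 1) :
    c ∈ interior (integrableExpSet (fun x : ℝ => x ^ 2) (gaussianReal μ V)) := by
  have hopen : IsOpen {c : ℝ | 2 * (V : ℝ) * c < 1} :=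
    isOpen_lt (by fun_prop) continuous_const
  exact mem_interior.2 ⟨_, fun c hc => integrable_exp_sq_gaussianReal hc, hopen, hc⟩

theorem norm_complexMGF_sq_gaussianReal_le {c : ℝ} (hc : 2 * (V : ℝ) * c < 1) {z : ℂ}
    (hz : z.re ≤ c) :
    ‖complexMGF (fun x : ℝ => x ^ 2) (gaussianReal μ V) z‖ ≤
      ∫ x, Real.exp (c * x ^ 2) ∂(gaussianReal μ V) := by
  refine norm_integral_le_of_norm_le (integrable_exp_sq_gaussianReal hc)
    (Eventually.of_forall fun x => ?_)
  rw [Complex.norm_exp, Complex.re_mul_ofReal]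
  exact Real.exp_le_exp.2 (mul_le_mul_of_nonneg_right hz (sq_nonneg x))

end GaussianSquare

theorem complexMGF_conj {Ω : Type*} {mΩ : MeasurableSpace Ω} (X : Ω → ℝ) (μ : Measure Ω) (z : ℂ) :
    complexMGF X μ (starRingEnd ℂ z) = starRingEnd ℂ (complexMGF X μ z) := by
  rw [complexMGF, complexMGF, ← integral_conj]
  congr 1; ext x
  rw [← Complex.exp_conj, map_mul, Complex.conj_ofReal]

theorem measurable_complexMGF {Ω : Type*} {mΩ : MeasurableSpace Ω} {X : Ω → ℝ} (hX : Measurable X)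
    (μ : Measure Ω) [SFinite μ] : Measurable (complexMGF X μ) := by
  have : StronglyMeasurable (fun q : ℂ × Ω => Complex.exp (q.1 * X q.2)) := by
    apply Measurable.stronglyMeasurable; fun_prop
  exact this.integral_prod_right.measurable

/-! ### Holomorphic integrals depending on a parameter -/

/-- A dominated integral of holomorphic functions is holomorphic: Cauchy's estimate turns the bound
on the integrand into one on its derivative. -/
theorem differentiableAt_integral_of_dominated {α : Type*} [MeasurableSpace α] {μ : Measure α}
    {U : Set ℂ} (hU : IsOpen U) {F : ℂ → α → ℂ} {bound : α → ℝ}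
    (hmeas : ∀ z ∈ U, AEStronglyMeasurable (F z) μ)
    (hdiff : ∀ᵐ a ∂μ, DifferentiableOn ℂ (fun z => F z a) U)
    (hb : ∀ᵐ a ∂μ, ∀ z ∈ U, ‖F z a‖ ≤ bound a) (hi : Integrable bound μ) {z₀ : ℂ} (h0 : z₀ ∈ U) :
    DifferentiableAt ℂ (fun z => ∫ a, F z a ∂μ) z₀ := by
  obtain ⟨ρ', hρ', hsub⟩ := Metric.nhds_basis_closedBall.mem_iff.1 (hU.mem_nhds h0)
  set ρ := ρ' / 2 with hρdef
  have hρ : 0 < ρ := by positivity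
  have hsub' : ∀ z ∈ Metric.ball z₀ ρ, Metric.closedBall z ρ ⊆ U := by
    intro z hz
    refine (Metric.closedBall_subset_closedBall' ?_).trans hsub
    have := (Metric.mem_ball.1 hz).le
    linarith
  have hz0 : z₀ ∈ Metric.ball z₀ ρ := Metric.mem_ball_self hρ
  have hballU : Metric.ball z₀ ρ ⊆ U :=
    fun z hz => hsub' z hz (Metric.mem_closedBall_self hρ.le)
  have hda : ∀ᵐ a ∂μ, ∀ z ∈ U, HasDerivAt (fun z => F z a) (deriv (fun z => F z a) z) z := by
    filter_upwards [hdiff] with a ha z hz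
    exact (ha.differentiableAt (hU.mem_nhds hz)).hasDerivAt
  refine (hasDerivAt_integral_of_dominated_loc_of_deriv_le (s := Metric.ball z₀ ρ)
    (F' := fun z a => deriv (fun z => F z a) z) (bound := fun a => bound a / ρ)
    (Metric.ball_mem_nhds _ hρ) ?_ ?_ ?_ ?_ (hi.div_const ρ) ?_).2.differentiableAt
  · filter_upwards [hU.mem_nhds h0] with z hz using hmeas z hz
  · exact hi.mono' (hmeas z₀ h0) (by filter_upwards [hb] with a ha using ha z₀ h0)
  · -- the derivative is a pointwise limit of difference quotients
    have hseq : ∀ n : ℕ, z₀ + ((ρ / (n + 2) : ℝ) : ℂ) ∈ U := by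
      intro n
      apply hballU
      rw [Metric.mem_ball, dist_eq_norm, add_sub_cancel_left, Complex.norm_real,
        Real.norm_of_nonneg (by positivity)]
      exact div_lt_self hρ (by linarith [(Nat.cast_nonneg n : (0 : ℝ) ≤ n)])
    have hlim : Tendsto (fun n : ℕ => ((ρ / (n + 2) : ℝ) : ℂ)) atTop (𝓝[≠] 0) := by
      rw [tendsto_nhdsWithin_iff]
      refine ⟨?_, Eventually.of_forall fun n => ?_⟩
      · have : Tendsto (fun n : ℕ => ρ / ((n : ℝ) + 2)) atTop (𝓝 0) :=
          tendsto_const_nhds.div_atTop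
            (tendsto_atTop_add_const_right _ _ tendsto_natCast_atTop_atTop)
        rw [← Complex.ofReal_zero]
        exact (Complex.continuous_ofReal.tendsto _).comp this
      · have : ρ / ((n : ℝ) + 2) ≠ 0 := by positivity
        simpa only [mem_compl_iff, mem_singleton_iff, Complex.ofReal_eq_zero] using this
    refine aestronglyMeasurable_of_tendsto_ae atTop (f := fun n : ℕ => fun a =>
      ((ρ / (n + 2) : ℝ) : ℂ)⁻¹ • (F (z₀ + ((ρ / (n + 2) : ℝ) : ℂ)) a - F z₀ a)) ?_ ?_
    · intro n
      exact ((hmeas _ (hseq n)).sub (hmeas z₀ h0)).const_smul ((ρ / (n + 2) : ℝ) : ℂ)⁻¹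
    · filter_upwards [hda] with a ha
      exact (hasDerivAt_iff_tendsto_slope_zero.1 (ha z₀ h0)).comp hlim
  · filter_upwards [hb, hdiff] with a ha hd z hz
    refine Complex.norm_deriv_le_of_forall_mem_sphere_norm_le hρ ?_ ?_
    · refine ⟨hd.mono ((Metric.ball_subset_closedBall).trans (hsub' z hz)), ?_⟩
      rw [closure_ball _ hρ.ne']
      exact hd.continuousOn.mono (hsub' z hz)
    · intro w hw
      exact ha w (hsub' z hz (Metric.sphere_subset_closedBall hw))
  · filter_upwards [hda] with a ha z hz using ha z (hballU hz)

/-! ### Path loss, measurability and conjugation symmetry -/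

namespace RISNetwork

variable {p : RISNetwork}

theorem g_pos (hp : p.Admissible) {d : ℝ} (hd : 0 ≤ d) : 0 < p.g d :=
  mul_pos hp.β_pos (Real.rpow_pos_of_pos (by linarith) _)

theorem g_le_g (hp : p.Admissible) {d e : ℝ} (hd : 0 ≤ d) (hde : d ≤ e) : p.g e ≤ p.g d := by
  have := hp.two_lt_α
  exact mul_le_mul_of_nonneg_left (Real.rpow_le_rpow_of_nonpos (by linarith) (by linarith)
    (by linarith)) hp.β_pos.le

theorem g_div_g (hp : p.Admissible) {r x : ℝ} (hr : 0 ≤ r) (hx : 0 ≤ x) :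
    p.g x / p.g r = ((r + 1) / (x + 1)) ^ p.α := by
  have h1 : 0 < r + 1 := by linarith
  have h2 : 0 < x + 1 := by linarith
  have h3 := Real.rpow_pos_of_pos h1 p.α
  have h4 := Real.rpow_pos_of_pos h2 p.α
  have := hp.β_pos
  rw [g, g, Real.rpow_neg h1.le, Real.rpow_neg h2.le, Real.div_rpow h1.le h2.le]
  field_simp

theorem continuousOn_g : ContinuousOn p.g (Ici 0) := by
  refine continuousOn_const.mul (ContinuousOn.rpow_const (by fun_prop) ?_)
  intro x hx
  left
  have : (0 : ℝ) ≤ x := hx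
  positivity

theorem continuousOn_G : ContinuousOn (fun q : ℝ × ℝ × ℝ => p.G q.1 q.2.1 q.2.2)
    {q | 0 ≤ q.2.1} := by
  refine ContinuousOn.mul ?_ ?_
  · exact continuousOn_g.comp (by fun_prop) (fun q hq => hq)
  · refine continuousOn_g.comp (Continuous.continuousOn (by fun_prop)) (fun q _ => ?_)
    exact Real.sqrt_nonneg _

theorem G_pos (hp : p.Admissible) {r y ψ : ℝ} (hy : 0 ≤ y) : 0 < p.G r y ψ :=
  mul_pos (g_pos hp hy) (g_pos hp (Real.sqrt_nonneg _))

@[fun_prop]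
theorem measurable_g : Measurable p.g := by
  unfold g
  fun_prop

theorem measurable_LD : Measurable LD := by
  have := isProbabilityMeasure_expMeasure (r := 1) one_pos
  exact (measurable_complexMGF measurable_id _).comp measurable_neg

theorem measurable_LR : Measurable p.LR :=
  (measurable_complexMGF (by fun_prop) _).comp measurable_neg

theorem measurable_expoBS : Measurable (fun q : ℝ × ℝ × ℂ => p.expoBS q.1 q.2.1 q.2.2) := by
  have hm : Measurable (fun q : (ℝ × ℝ × ℂ) × ℝ =>
      (q.2 : ℂ) * (1 - LD (q.1.2.2 * ((q.1.2.1 * p.P₀ * p.g q.2 : ℝ) : ℂ)))) := by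
    have h1 : Measurable (fun q : (ℝ × ℝ × ℂ) × ℝ =>
        q.1.2.2 * ((q.1.2.1 * p.P₀ * p.g q.2 : ℝ) : ℂ)) := by fun_prop
    have h2 := measurable_LD.comp h1
    exact (by fun_prop : Measurable fun q : (ℝ × ℝ × ℂ) × ℝ => (q.2 : ℂ)).mul
      (measurable_const.sub h2)
  have hs : MeasurableSet {q : (ℝ × ℝ × ℂ) × ℝ | q.1.1 < q.2} :=
    measurableSet_lt (by fun_prop) (by fun_prop)
  have h := ((hm.indicator hs).stronglyMeasurable.integral_prod_right' (ν := volume)).measurable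
  have e : (fun q : ℝ × ℝ × ℂ => p.expoBS q.1 q.2.1 q.2.2) = fun q => 2 * (Real.pi : ℂ) *
      ∫ x : ℝ, {q : (ℝ × ℝ × ℂ) × ℝ | q.1.1 < q.2}.indicator (fun q : (ℝ × ℝ × ℂ) × ℝ =>
      (q.2 : ℂ) * (1 - LD (q.1.2.2 * ((q.1.2.1 * p.P₀ * p.g q.2 : ℝ) : ℂ)))) (q, x) := by
    ext q
    rw [expoBS, ← integral_indicator measurableSet_Ioi]
    rfl
  rw [e]
  exact h.const_mul _

theorem measurable_expoRIS (hp : p.Admissible) :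
    Measurable (fun q : ℝ × ℂ => p.expoRIS q.1 q.2) := by
  have hm : Measurable (fun q : ((ℝ × ℂ) × ℝ) × ℝ =>
      (q.1.2 : ℂ) * (1 - p.LR (-(q.1.1.2 * ((p.P₀ * p.G q.1.1.1 q.1.2 q.2 : ℝ) : ℂ))))) := by
    have h1 : Measurable (fun q : ((ℝ × ℂ) × ℝ) × ℝ =>
        -(q.1.1.2 * ((p.P₀ * p.G q.1.1.1 q.1.2 q.2 : ℝ) : ℂ))) := by
      unfold G
      fun_prop
    have h2 := measurable_LR (p := p) |>.comp h1
    exact (by fun_prop : Measurable fun q : ((ℝ × ℂ) × ℝ) × ℝ => (q.1.2 : ℂ)).mul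
      (measurable_const.sub h2)
  have h := (hm.stronglyMeasurable.integral_prod_right'
    (ν := volume.restrict (Ioc 0 (2 * Real.pi)))).integral_prod_right'
    (ν := volume.restrict (Ioc p.Rin p.Rout))
  have e : (fun q : ℝ × ℂ => p.expoRIS q.1 q.2) = fun q =>
      ∫ y in Ioc p.Rin p.Rout, ∫ ψ in Ioc 0 (2 * Real.pi),
        (y : ℂ) * (1 - p.LR (-(q.2 * ((p.P₀ * p.G q.1 y ψ : ℝ) : ℂ)))) := by
    ext q
    rw [expoRIS, intervalIntegral.integral_of_le hp.Rin_lt_Rout.le]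
    simp only [intervalIntegral.integral_of_le Real.two_pi_pos.le]
  rw [e]
  exact h.measurable

theorem expoBS_conj (r t : ℝ) (z : ℂ) :
    p.expoBS r t (starRingEnd ℂ z) = starRingEnd ℂ (p.expoBS r t z) := by
  rw [expoBS, expoBS, map_mul, ← integral_conj]
  congr 1
  · simp only [map_mul, map_ofNat, Complex.conj_ofReal]
  · congr 1; ext x
    simp only [map_mul, map_sub, map_one, Complex.conj_ofReal, LD, ← complexMGF_conj, map_neg]

theorem expoRIS_conj (r : ℝ) (z : ℂ) :
    p.expoRIS r (starRingEnd ℂ z) = starRingEnd ℂ (p.expoRIS r z) := by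
  rw [expoRIS, expoRIS, ← intervalIntegral.intervalIntegral_conj]
  congr 1; ext y
  rw [← intervalIntegral.intervalIntegral_conj]
  congr 1; ext ψ
  simp only [map_mul, map_sub, map_one, Complex.conj_ofReal, LR, ← complexMGF_conj, map_neg]

theorem B_conj (lB lR r t : ℝ) (z : ℂ) :
    p.B lB lR r t (starRingEnd ℂ z) = starRingEnd ℂ (p.B lB lR r t z) := by
  simp only [B, map_mul, ← Complex.exp_conj, map_neg, Complex.conj_ofReal, expoBS_conj,
    expoRIS_conj]

/-! ### The exponents on the region of convergence -/

theorem one_sub_LD {w : ℂ} (hw : -1 < w.re) : 1 - LD w = w / (1 + w) := by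
  have h2 : 1 + w ≠ 0 := fun h => by
    have := congrArg Complex.re h
    simp at this
    linarith
  rw [LD_eq hw]
  field_simp
  ring

theorem integrableOn_id_mul_g (hp : p.Admissible) {r : ℝ} (hr : 0 ≤ r) :
    IntegrableOn (fun x => x * p.g x) (Ioi r) := by
  have h2 := hp.two_lt_α
  have h := (integrableOn_add_rpow_Ioi_of_lt (a := 1 - p.α) (c := r) (m := 1) (by linarith)
    (by linarith)).const_mul p.β
  refine h.mono' (by apply Measurable.aestronglyMeasurable; fun_prop) ?_
  filter_upwards [ae_restrict_mem measurableSet_Ioi] with x hx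
  have hx0 : 0 ≤ x := hr.trans (le_of_lt hx)
  have hβ := hp.β_pos
  rw [Real.norm_of_nonneg (mul_nonneg hx0 (g_pos hp hx0).le), g, sub_eq_add_neg,
    Real.rpow_add (by positivity), Real.rpow_one]
  have := Real.rpow_nonneg (by linarith : 0 ≤ x + 1) (-p.α)
  nlinarith [mul_nonneg hβ.le this]

/-- The integrand of `expoBS` is locally dominated on the region of convergence. -/
theorem expoBS_dominated (hp : p.Admissible) {r t : ℝ} (hr : 0 ≤ r) (ht : 0 < t) {z₀ : ℂ}
    (hz : -1 < z₀.re * (t * p.P₀ * p.g r)) :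
    ∃ U : Set ℂ, IsOpen U ∧ z₀ ∈ U ∧ ∃ C : ℝ, ∀ z ∈ U, ∀ x ∈ Ioi r,
      -1 < z.re * (t * p.P₀ * p.g x) ∧
      ‖(x : ℂ) * (1 - LD (z * ((t * p.P₀ * p.g x : ℝ) : ℂ)))‖ ≤ C * (x * p.g x) := by
  have hP := hp.P₀_pos
  have hgr := g_pos hp hr
  have ha : 0 < t * p.P₀ * p.g r := by positivity
  set a := t * p.P₀ * p.g r with hadef
  -- `m` lies strictly between `max 0 (-re z₀)` and the edge `1 / a` of the strip
  set m0 := max 0 (-z₀.re) with hm0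
  have hm0a : m0 * a < 1 := by
    rcases max_cases 0 (-z₀.re) with h | h <;> rw [hm0, h.1] <;> linarith
  set m := (m0 + 1 / a) / 2 with hm
  have hm0' : m0 < 1 / a := by rwa [lt_div_iff₀ ha]
  have hm1 : m0 < m := by linarith
  have hm2 : m * a < 1 := by rw [← lt_div_iff₀ ha]; linarith
  have hmpos : 0 ≤ m := (le_max_left _ _).trans hm1.le
  refine ⟨{z | -m < z.re ∧ ‖z‖ < ‖z₀‖ + 1}, ?_, ?_, (‖z₀‖ + 1) * (t * p.P₀) / (1 - m * a), ?_⟩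
  · exact (isOpen_lt continuous_const Complex.continuous_re).inter
      (isOpen_lt continuous_norm continuous_const)
  · exact ⟨by linarith [le_max_right 0 (-z₀.re)], by linarith⟩
  · rintro z ⟨hz1, hz2⟩ x hx
    have hxr : r < x := hx
    have hx0 : 0 < x := by linarith
    have hgx := g_pos hp hx0.le
    have hax : t * p.P₀ * p.g x ≤ a :=
      mul_le_mul_of_nonneg_left (g_le_g hp hr hxr.le) (by positivity)
    have hax0 : 0 < t * p.P₀ * p.g x := by positivity
    have hlow : -(m * a) ≤ z.re * (t * p.P₀ * p.g x) := by nlinarith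
    have hre : -1 < z.re * (t * p.P₀ * p.g x) := by linarith
    refine ⟨hre, ?_⟩
    set w := z * ((t * p.P₀ * p.g x : ℝ) : ℂ) with hw
    have hwre : w.re = z.re * (t * p.P₀ * p.g x) := by rw [hw, Complex.re_mul_ofReal]
    rw [one_sub_LD (by rw [hwre]; exact hre), norm_mul, norm_div, Complex.norm_real,
      Real.norm_of_nonneg hx0.le]
    have h1 : 1 - m * a ≤ ‖1 + w‖ := by
      refine le_trans ?_ (Complex.re_le_norm _)
      rw [Complex.add_re, Complex.one_re, hwre]; linarith
    have h2 : ‖w‖ ≤ (‖z₀‖ + 1) * (t * p.P₀ * p.g x) := by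
      rw [hw, norm_mul, Complex.norm_real, Real.norm_of_nonneg hax0.le]
      gcongr
    have h3 : 0 < 1 - m * a := by linarith
    calc x * (‖w‖ / ‖1 + w‖) ≤ x * (((‖z₀‖ + 1) * (t * p.P₀ * p.g x)) / (1 - m * a)) := by
          gcongr
      _ = _ := by field_simp

theorem measurable_expoBS_integrand (t : ℝ) (z : ℂ) : Measurable (fun x : ℝ => (x : ℂ) *
    (1 - LD (z * ((t * p.P₀ * p.g x : ℝ) : ℂ)))) := by
  have h1 : Measurable (fun x : ℝ => z * ((t * p.P₀ * p.g x : ℝ) : ℂ)) := by fun_prop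
  exact (by fun_prop : Measurable fun x : ℝ => (x : ℂ)).mul
    (measurable_const.sub (measurable_LD.comp h1))

theorem integrableOn_expoBS (hp : p.Admissible) {r t : ℝ} (hr : 0 ≤ r) (ht : 0 < t) {z : ℂ}
    (hz : -1 < z.re * (t * p.P₀ * p.g r)) :
    IntegrableOn (fun x : ℝ => (x : ℂ) * (1 - LD (z * ((t * p.P₀ * p.g x : ℝ) : ℂ)))) (Ioi r) := by
  obtain ⟨U, -, hzU, C, hC⟩ := expoBS_dominated hp hr ht hz
  refine ((integrableOn_id_mul_g hp hr).const_mul C).mono'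
    (measurable_expoBS_integrand t z).aestronglyMeasurable ?_
  filter_upwards [ae_restrict_mem measurableSet_Ioi] with x hx using (hC z hzU x hx).2

theorem differentiableAt_LD {w : ℂ} (hw : -1 < w.re) : DifferentiableAt ℂ LD w := by
  have h2 : 1 + w ≠ 0 := fun h => by
    have := congrArg Complex.re h
    simp at this
    linarith
  have hd : DifferentiableAt ℂ (fun w : ℂ => 1 / (1 + w)) w := by fun_prop (disch := exact h2)
  refine hd.congr_of_eventuallyEq ?_
  filter_upwards [(isOpen_lt continuous_const Complex.continuous_re).mem_nhds hw] with v hv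
  exact LD_eq hv

theorem differentiableAt_expoBS (hp : p.Admissible) {r t : ℝ} (hr : 0 ≤ r) (ht : 0 < t) {z : ℂ}
    (hz : -1 < z.re * (t * p.P₀ * p.g r)) : DifferentiableAt ℂ (p.expoBS r t) z := by
  obtain ⟨U, hU, hzU, C, hC⟩ := expoBS_dominated hp hr ht hz
  refine (differentiableAt_integral_of_dominated (μ := volume.restrict (Ioi r)) hU
    (F := fun z (x : ℝ) => (x : ℂ) * (1 - LD (z * ((t * p.P₀ * p.g x : ℝ) : ℂ))))
    (fun z _ => (measurable_expoBS_integrand t z).aestronglyMeasurable) ?_ ?_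
    ((integrableOn_id_mul_g hp hr).const_mul C) hzU).const_mul _
  · filter_upwards [ae_restrict_mem measurableSet_Ioi] with x hx z hzU
    have h1 := (hC z hzU x hx).1
    have h2 : DifferentiableAt ℂ (fun z : ℂ => LD (z * ((t * p.P₀ * p.g x : ℝ) : ℂ))) z :=
      DifferentiableAt.comp (f := fun z : ℂ => z * ((t * p.P₀ * p.g x : ℝ) : ℂ)) z
        (differentiableAt_LD (by rw [Complex.re_mul_ofReal]; exact h1))
        (differentiableAt_id.mul_const _)
    exact ((h2.const_sub 1).const_mul _).differentiableWithinAt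
  · filter_upwards [ae_restrict_mem measurableSet_Ioi] with x hx z hzU using (hC z hzU x hx).2

/-- The domain of integration over the position of a reflecting panel, in polar coordinates. It is
closed, so that continuous functions attain their maximum on it. -/
def panelDomain (p : RISNetwork) : Set (ℝ × ℝ) := Icc p.Rin p.Rout ×ˢ Icc (0 : ℝ) (2 * Real.pi)

theorem isCompact_panelDomain : IsCompact p.panelDomain := isCompact_Icc.prod isCompact_Icc

theorem measurableSet_panelDomain : MeasurableSet p.panelDomain := measurableSet_Icc.prod measurableSet_Icc

theorem panelDomain_nonempty (hp : p.Admissible) : p.panelDomain.Nonempty :=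
  ⟨(p.Rin, 0), ⟨left_mem_Icc.2 hp.Rin_lt_Rout.le, left_mem_Icc.2 Real.two_pi_pos.le⟩⟩

/-- Bound for the transform of the reflected power when the exponent stays at most `c`. -/
def reflBound (p : RISNetwork) (c : ℝ) : ℝ :=
  ∫ x, Real.exp (c * x ^ 2) ∂(gaussianReal (p.M * p.meanZ) (p.M * p.varZ))

theorem reflBound_nonneg (c : ℝ) : 0 ≤ p.reflBound c :=
  integral_nonneg fun _ => (Real.exp_pos _).le

theorem norm_LR_neg_le {c : ℝ} (hc : 2 * (p.M * p.varZ) * c < 1) {w : ℂ} (hw : w.re ≤ c) :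
    ‖p.LR (-w)‖ ≤ p.reflBound c := by
  rw [LR, neg_neg]
  exact norm_complexMGF_sq_gaussianReal_le (by push_cast; exact hc) hw

theorem differentiableAt_LR_neg {w : ℂ} (hw : 2 * (p.M * p.varZ) * w.re < 1) :
    DifferentiableAt ℂ (fun w => p.LR (-w)) w := by
  simp only [LR, neg_neg]
  exact (hasDerivAt_complexMGF (mem_interior_integrableExpSet_sq_gaussianReal
    (by push_cast; exact hw))).differentiableAt

/-- The integrand of `expoRIS` is locally dominated on the region of convergence. -/
theorem expoRIS_dominated (hp : p.Admissible) {r : ℝ} {z₀ : ℂ}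
    (hz : ∀ q ∈ p.panelDomain, 2 * (p.M * p.varZ) * (z₀.re * (p.P₀ * p.G r q.1 q.2)) < 1) :
    ∃ U : Set ℂ, IsOpen U ∧ z₀ ∈ U ∧ ∃ C : ℝ, ∀ z ∈ U, ∀ q ∈ p.panelDomain,
      2 * (p.M * p.varZ) * (z.re * (p.P₀ * p.G r q.1 q.2)) < 1 ∧
      ‖(q.1 : ℂ) * (1 - p.LR (-(z * ((p.P₀ * p.G r q.1 q.2 : ℝ) : ℂ))))‖ ≤ C := by
  have hP := hp.P₀_pos
  have hRin := hp.Rin_nonneg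
  have hcont : ContinuousOn (fun q : ℝ × ℝ => p.P₀ * p.G r q.1 q.2) p.panelDomain :=
    continuousOn_const.mul (continuousOn_G.comp (f := fun q : ℝ × ℝ => (r, q.1, q.2))
      (by fun_prop) (fun q hq => hRin.trans hq.1.1))
  obtain ⟨q₀, hq₀, hmax⟩ := isCompact_panelDomain.exists_isMaxOn (panelDomain_nonempty hp) hcont
  have hbpos : ∀ q ∈ p.panelDomain, 0 < p.P₀ * p.G r q.1 q.2 := fun q hq =>
    mul_pos hP (G_pos hp (hRin.trans hq.1.1))
  set b := p.P₀ * p.G r q₀.1 q₀.2 with hb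
  have hb0 : 0 < b := hbpos q₀ hq₀
  set V : ℝ := p.M * p.varZ with hV
  have hV0 : 0 ≤ V := by positivity
  set m0 := max 0 z₀.re with hm0
  set Q := 2 * V * b with hQ
  have hQ0 : 0 ≤ Q := by positivity
  have hQm : Q * m0 < 1 := by
    have := hz q₀ hq₀
    rcases max_cases 0 z₀.re with h | h <;> rw [hm0, h.1]
    · simp
    · rw [hQ]; linarith
  -- `m > max 0 (re z₀)` with `Q * m < 1`; dividing by `Q + 1` covers the degenerate case `Q = 0`
  set m := m0 + (1 - Q * m0) / (Q + 1) with hm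
  have hm1 : m0 < m := by
    have : 0 < (1 - Q * m0) / (Q + 1) := by apply div_pos <;> linarith
    linarith
  have hm2 : Q * m < 1 := by
    have : Q * m = 1 - (1 - Q * m0) / (Q + 1) := by rw [hm]; field_simp; ring
    have h' : 0 < (1 - Q * m0) / (Q + 1) := by apply div_pos <;> linarith
    linarith
  have hmpos : 0 ≤ m := (le_max_left _ _).trans hm1.le
  have hc : 2 * V * (m * b) < 1 := by rw [hQ] at hm2; linarith
  refine ⟨{z | z.re < m}, isOpen_lt Complex.continuous_re continuous_const,
    lt_of_le_of_lt (le_max_right _ _) hm1, p.Rout * (1 + p.reflBound (m * b)), ?_⟩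
  intro z hz q hq
  have hzm : z.re < m := hz
  have h1 : z.re * (p.P₀ * p.G r q.1 q.2) ≤ m * b := by
    have := hbpos q hq
    have h2 : p.P₀ * p.G r q.1 q.2 ≤ b := hmax hq
    nlinarith
  refine ⟨lt_of_le_of_lt (mul_le_mul_of_nonneg_left h1 (by positivity)) hc, ?_⟩
  have h0 : 0 ≤ q.1 := hRin.trans hq.1.1
  rw [norm_mul, Complex.norm_real, Real.norm_of_nonneg h0]
  have h3 := norm_LR_neg_le (p := p) hc (w := z * ((p.P₀ * p.G r q.1 q.2 : ℝ) : ℂ))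
    (by rw [Complex.re_mul_ofReal]; exact h1)
  have h4 := norm_sub_le (1 : ℂ) (p.LR (-(z * ((p.P₀ * p.G r q.1 q.2 : ℝ) : ℂ))))
  rw [norm_one] at h4
  exact mul_le_mul hq.1.2 (by linarith) (norm_nonneg _) (h0.trans hq.1.2)

theorem measurable_expoRIS_integrand (r : ℝ) (z : ℂ) : Measurable (fun q : ℝ × ℝ => (q.1 : ℂ) *
    (1 - p.LR (-(z * ((p.P₀ * p.G r q.1 q.2 : ℝ) : ℂ))))) := by
  have h1 : Measurable (fun q : ℝ × ℝ => -(z * ((p.P₀ * p.G r q.1 q.2 : ℝ) : ℂ))) := by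
    unfold G
    fun_prop
  exact (by fun_prop : Measurable fun q : ℝ × ℝ => (q.1 : ℂ)).mul
    (measurable_const.sub (measurable_LR.comp h1))

theorem integrableOn_const_panelDomain (C : ℝ) : IntegrableOn (fun _ : ℝ × ℝ => C) p.panelDomain :=
  integrableOn_const isCompact_panelDomain.measure_lt_top.ne

theorem integrableOn_expoRIS (hp : p.Admissible) {r : ℝ} {z : ℂ}
    (hz : ∀ q ∈ p.panelDomain, 2 * (p.M * p.varZ) * (z.re * (p.P₀ * p.G r q.1 q.2)) < 1) :
    IntegrableOn (fun q : ℝ × ℝ => (q.1 : ℂ) *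
      (1 - p.LR (-(z * ((p.P₀ * p.G r q.1 q.2 : ℝ) : ℂ))))) p.panelDomain := by
  obtain ⟨U, -, hzU, C, hC⟩ := expoRIS_dominated hp hz
  refine (integrableOn_const_panelDomain C).mono'
    (measurable_expoRIS_integrand r z).aestronglyMeasurable ?_
  filter_upwards [ae_restrict_mem measurableSet_panelDomain] with x hx using (hC z hzU x hx).2

theorem expoRIS_eq_integral_panelDomain (hp : p.Admissible) {r : ℝ} {z : ℂ}
    (hz : ∀ q ∈ p.panelDomain, 2 * (p.M * p.varZ) * (z.re * (p.P₀ * p.G r q.1 q.2)) < 1) :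
    p.expoRIS r z = ∫ q in p.panelDomain, (q.1 : ℂ) *
      (1 - p.LR (-(z * ((p.P₀ * p.G r q.1 q.2 : ℝ) : ℂ)))) := by
  rw [expoRIS, panelDomain, Measure.volume_eq_prod, setIntegral_prod _ (integrableOn_expoRIS hp hz),
    intervalIntegral.integral_of_le hp.Rin_lt_Rout.le, integral_Icc_eq_integral_Ioc]
  simp only [intervalIntegral.integral_of_le Real.two_pi_pos.le, integral_Icc_eq_integral_Ioc]

theorem differentiableAt_expoRIS (hp : p.Admissible) {r : ℝ} {z : ℂ}
    (hz : ∀ q ∈ p.panelDomain, 2 * (p.M * p.varZ) * (z.re * (p.P₀ * p.G r q.1 q.2)) < 1) :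
    DifferentiableAt ℂ (p.expoRIS r) z := by
  obtain ⟨U, hU, hzU, C, hC⟩ := expoRIS_dominated hp hz
  have hd := differentiableAt_integral_of_dominated (μ := volume.restrict p.panelDomain) hU
    (F := fun z (q : ℝ × ℝ) => (q.1 : ℂ) *
      (1 - p.LR (-(z * ((p.P₀ * p.G r q.1 q.2 : ℝ) : ℂ)))))
    (fun z _ => (measurable_expoRIS_integrand r z).aestronglyMeasurable)
    (by
      filter_upwards [ae_restrict_mem measurableSet_panelDomain] with q hq z hzU
      have h1 := (hC z hzU q hq).1
      have h2 : DifferentiableAt ℂ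
          (fun z : ℂ => p.LR (-(z * ((p.P₀ * p.G r q.1 q.2 : ℝ) : ℂ)))) z :=
        DifferentiableAt.comp (f := fun z : ℂ => z * ((p.P₀ * p.G r q.1 q.2 : ℝ) : ℂ)) z
          (differentiableAt_LR_neg (by rw [Complex.re_mul_ofReal]; exact h1))
          (differentiableAt_id.mul_const _)
      exact ((h2.const_sub 1).const_mul _).differentiableWithinAt)
    (by filter_upwards [ae_restrict_mem measurableSet_panelDomain] with q hq z hzU using (hC z hzU q hq).2)
    (integrableOn_const_panelDomain C) hzU
  refine hd.congr_of_eventuallyEq ?_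
  filter_upwards [hU.mem_nhds hzU] with w hw
  exact expoRIS_eq_integral_panelDomain hp fun q hq => (hC w hw q hq).1

end RISNetwork

/-! ### Elementary inequalities -/

/-- A Gaussian in `y ^ (1/α) - 1` decays faster than the square of `1 + y`. -/
theorem exp_neg_sq_posPart_rpow_le {α k : ℝ} (hα : 0 < α) (hk : 0 < k) {y : ℝ} (hy : 0 ≤ y) :
    Real.exp (-(k * (max (y ^ (1 / α) - 1) 0) ^ 2)) ≤
      4 * Real.exp (α ^ 2 / k) / (1 + y) ^ 2 := by
  set x := max (y ^ (1 / α) - 1) 0 with hx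
  have hx0 : 0 ≤ x := le_max_right _ _
  have hyx : y ≤ (1 + x) ^ α := by
    have h1 : y ^ (1 / α) ≤ 1 + x := by linarith [le_max_left (y ^ (1 / α) - 1) 0]
    have h2 := Real.rpow_le_rpow (Real.rpow_nonneg hy _) h1 hα.le
    rwa [← Real.rpow_mul hy, one_div_mul_cancel hα.ne', Real.rpow_one] at h2
  have h1x : (1 + x) ^ α ≤ Real.exp (α * x) := by
    rw [mul_comm, Real.exp_mul]
    exact Real.rpow_le_rpow (by positivity) (by linarith [Real.add_one_le_exp x]) hα.le
  have h3 : 1 + y ≤ 2 * Real.exp (α * x) := by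
    have : (1 : ℝ) ≤ Real.exp (α * x) := Real.one_le_exp (by positivity)
    linarith
  have h4 : (1 + y) ^ 2 ≤ 4 * Real.exp (2 * α * x) := by
    calc (1 + y) ^ 2 ≤ (2 * Real.exp (α * x)) ^ 2 := by gcongr
      _ = 4 * Real.exp (2 * α * x) := by
        rw [mul_pow, ← Real.exp_nat_mul]; norm_num; ring_nf
  have h5 : 2 * α * x - k * x ^ 2 ≤ α ^ 2 / k := by
    rw [le_div_iff₀ hk]
    nlinarith [sq_nonneg (k * x - α)]
  rw [le_div_iff₀ (by positivity)]
  calc Real.exp (-(k * x ^ 2)) * (1 + y) ^ 2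
      ≤ Real.exp (-(k * x ^ 2)) * (4 * Real.exp (2 * α * x)) := by gcongr
    _ = 4 * Real.exp (2 * α * x - k * x ^ 2) := by
      rw [sub_eq_add_neg, Real.exp_add]; ring
    _ ≤ _ := by gcongr

theorem norm_div_one_add_le {w : ℂ} (hw : 0 ≤ w.re) : ‖w / (1 + w)‖ ≤ ‖w‖ := by
  rw [norm_div]
  apply div_le_self (norm_nonneg _)
  refine le_trans ?_ (Complex.re_le_norm _)
  rw [Complex.add_re, Complex.one_re]; linarith

theorem re_div_one_add (w : ℂ) :
    (w / (1 + w)).re = (w.re + ‖w‖ ^ 2) / ‖1 + w‖ ^ 2 := by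
  rw [Complex.div_re, ← Complex.normSq_eq_norm_sq, ← Complex.normSq_eq_norm_sq,
    ← add_div, Complex.normSq_apply w]
  simp
  ring

theorem re_div_one_add_nonneg {w : ℂ} (hw : 0 ≤ w.re) : 0 ≤ (w / (1 + w)).re := by
  rw [re_div_one_add w]; positivity

theorem quarter_le_re_div_one_add {w : ℂ} (hw : 0 ≤ w.re) (h1 : 1 ≤ ‖w‖) :
    1 / 4 ≤ (w / (1 + w)).re := by
  have hn : ‖1 + w‖ ≤ 1 + ‖w‖ := by simpa using norm_add_le 1 w
  have hpos : 0 < ‖1 + w‖ := by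
    refine lt_of_lt_of_le ?_ (Complex.re_le_norm _)
    rw [Complex.add_re, Complex.one_re]; linarith
  rw [re_div_one_add w, le_div_iff₀ (by positivity)]
  have : ‖1 + w‖ ^ 2 ≤ (1 + ‖w‖) ^ 2 := by gcongr
  nlinarith

/-! ### Uniform bounds on the strip -/

namespace RISNetwork

variable {p : RISNetwork}

/-- The value `1 / (P₀ g(r))` as a real number. -/
def sVal (p : RISNetwork) (r : ℝ) : ℝ := 1 / (p.P₀ * p.g r)

theorem sArg_eq (r : ℝ) : p.sArg r = (p.sVal r : ℂ) := rfl

theorem sVal_pos (hp : p.Admissible) {r : ℝ} (hr : 0 ≤ r) : 0 < p.sVal r :=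
  one_div_pos.2 (mul_pos hp.P₀_pos (g_pos hp hr))

theorem sVal_mul_G (hp : p.Admissible) (r y ψ : ℝ) :
    p.sVal r * (p.P₀ * p.G r y ψ) = p.G r y ψ / p.g r := by
  have := hp.P₀_pos.ne'
  rw [sVal, one_div, mul_inv]
  field_simp

theorem tendsto_g_sub_div_g (hp : p.Admissible) (a : ℝ) :
    Tendsto (fun r => p.g (r - a) / p.g r) atTop (𝓝 1) := by
  have h1 : Tendsto (fun r : ℝ => (1 - a / (r + 1)) ^ (-p.α)) atTop (𝓝 1) := by
    have h0 : Tendsto (fun r : ℝ => 1 - a / (r + 1)) atTop (𝓝 1) := by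
      simpa using (tendsto_const_nhds (x := a)).div_atTop
        (tendsto_atTop_add_const_right atTop (1 : ℝ) tendsto_id) |>.const_sub 1
    have := h0.rpow_const (p := -p.α) (Or.inl one_ne_zero)
    simpa using this
  refine h1.congr' ?_
  filter_upwards [eventually_gt_atTop 0, eventually_gt_atTop a] with r hr ha
  have hβ := hp.β_pos.ne'
  have h2 : 0 < r + 1 := by linarith
  have h3 : 0 < r - a + 1 := by linarith
  rw [g, g, mul_div_mul_left _ _ hβ, ← Real.div_rpow h3.le h2.le]
  congr 1
  field_simp
  ring

/-- Uniformly in the distance `r` to the base station, the exponents met on the closed strip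
`0 ≤ re z ≤ s(r)` stay away from the singularity of the transform of the reflected power. For large
`r` the relevant ratio `G(r,y,ψ) / g(r)` is at most about `g(Rin)`, which is admissible because the
ratio exceeds `g(Rin)` at a panel lying between the user and the base station. -/
theorem exists_uniform_exponent (hp : p.Admissible)
    (hroc : ∀ r, p.Rc ≤ r → ∀ t : ℝ, 0 < t → p.sArg r ∈ p.roc r t) :
    ∃ c : ℝ, 0 ≤ c ∧ 2 * (p.M * p.varZ) * c < 1 ∧ ∀ r, p.Rc ≤ r → ∀ q ∈ p.panelDomain,
      p.sVal r * (p.P₀ * p.G r q.1 q.2) ≤ c := by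
  have hRc := hp.Rc_nonneg
  have hRin := hp.Rin_nonneg
  have hlt := hp.Rin_lt_Rout
  set Q : ℝ := 2 * (p.M * p.varZ) with hQ
  have hQ0 : 0 ≤ Q := by positivity
  have hroc' : ∀ r, p.Rc ≤ r → ∀ q ∈ p.panelDomain, Q * (p.G r q.1 q.2 / p.g r) < 1 := by
    intro r hr q hq
    rw [← sVal_mul_G hp]
    exact (hroc r hr 1 one_pos).2 q.1 hq.1 q.2 hq.2
  have hgin := g_pos hp hRin
  -- a panel at distance `Rin` in the direction of the base station
  have h0 : Q * p.g p.Rin < 1 := by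
    set r := max p.Rc p.Rout with hr
    have hr1 : p.Rc ≤ r := le_max_left _ _
    have hr2 : p.Rout ≤ r := le_max_right _ _
    have hgr : 0 < p.g r := g_pos hp (hRc.trans hr1)
    have h := hroc' r hr1 (p.Rin, 0)
      ⟨left_mem_Icc.2 hlt.le, left_mem_Icc.2 Real.two_pi_pos.le⟩
    refine lt_of_le_of_lt (mul_le_mul_of_nonneg_left ?_ hQ0) h
    rw [le_div_iff₀ hgr, G]
    refine mul_le_mul_of_nonneg_left (g_le_g hp (Real.sqrt_nonneg _) ?_) hgin.le
    rw [Real.sqrt_le_left (hRc.trans hr1), Real.cos_zero]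
    dsimp only
    nlinarith
  obtain ⟨η, hη1, hη2⟩ : ∃ η : ℝ, 1 < η ∧ Q * (p.g p.Rin * η) < 1 := by
    have hc : Tendsto (fun η : ℝ => Q * (p.g p.Rin * η)) (𝓝[>] 1) (𝓝 (Q * (p.g p.Rin * 1))) :=
      (Continuous.tendsto (by fun_prop) _).mono_left nhdsWithin_le_nhds
    rw [mul_one] at hc
    obtain ⟨η, h1, h2⟩ := ((hc.eventually (gt_mem_nhds h0)).and self_mem_nhdsWithin).exists
    exact ⟨η, h2, h1⟩
  obtain ⟨R₀, hR₀⟩ := eventually_atTop.1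
    ((tendsto_g_sub_div_g hp p.Rout).eventually (gt_mem_nhds hη1))
  set R₁ := max (max R₀ p.Rout) p.Rc with hR₁
  have hlarge : ∀ r, R₁ ≤ r → ∀ q ∈ p.panelDomain, p.G r q.1 q.2 / p.g r ≤ p.g p.Rin * η := by
    intro r hr q hq
    have hrR0 : R₀ ≤ r := ((le_max_left _ _).trans (le_max_left _ _)).trans hr
    have hrout : p.Rout ≤ r := ((le_max_right _ _).trans (le_max_left _ _)).trans hr
    have hr0 : 0 ≤ r := by linarith
    have hgr : 0 < p.g r := g_pos hp hr0
    have h1 := (hR₀ r hrR0).le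
    rw [G, mul_div_assoc]
    have hy0 : 0 ≤ q.1 := hRin.trans hq.1.1
    refine mul_le_mul (g_le_g hp hRin hq.1.1) (le_trans ?_ h1)
      (div_pos (g_pos hp (Real.sqrt_nonneg _)) hgr).le hgin.le
    refine div_le_div_of_nonneg_right (g_le_g hp (by linarith) ?_) hgr.le
    have h2 : r - p.Rout ≤ r - q.1 := by linarith [hq.1.2]
    refine h2.trans (Real.le_sqrt_of_sq_le ?_)
    nlinarith [Real.cos_le_one q.2, mul_nonneg hr0 hy0]
  have hcpt : IsCompact (Icc p.Rc R₁ ×ˢ p.panelDomain) := isCompact_Icc.prod isCompact_panelDomain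
  have hne : (Icc p.Rc R₁ ×ˢ p.panelDomain).Nonempty :=
    (nonempty_Icc.2 (le_max_right _ _)).prod (panelDomain_nonempty hp)
  have hcont : ContinuousOn (fun x : ℝ × ℝ × ℝ => p.G x.1 x.2.1 x.2.2 / p.g x.1)
      (Icc p.Rc R₁ ×ˢ p.panelDomain) := by
    refine ContinuousOn.div (continuousOn_G.mono fun _ hx => hRin.trans hx.2.1.1)
      (continuousOn_g.comp continuousOn_fst fun _ hx => hRc.trans hx.1.1)
      fun x hx => (g_pos hp (hRc.trans hx.1.1)).ne'
  obtain ⟨x, hx, hmax⟩ := hcpt.exists_isMaxOn hne hcont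
  refine ⟨max (p.g p.Rin * η) (p.G x.1 x.2.1 x.2.2 / p.g x.1),
    le_trans (by positivity) (le_max_left _ _), ?_, ?_⟩
  · rcases max_cases (p.g p.Rin * η) (p.G x.1 x.2.1 x.2.2 / p.g x.1) with h | h <;> rw [h.1]
    · exact hη2
    · exact hroc' x.1 hx.1.1 x.2 hx.2
  · intro r hr q hq
    rw [sVal_mul_G hp]
    rcases le_total R₁ r with h | h
    · exact (hlarge r h q hq).trans (le_max_left _ _)
    · exact le_trans (hmax (a := (r, q)) ⟨⟨hr, h⟩, hq⟩) (le_max_right _ _)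

theorem re_mul_le_of_strip (hp : p.Admissible) {c r : ℝ} {q : ℝ × ℝ}
    (hq : q ∈ p.panelDomain) (hc : p.sVal r * (p.P₀ * p.G r q.1 q.2) ≤ c) {z : ℂ} (hz : z.re ≤ p.sVal r) :
    z.re * (p.P₀ * p.G r q.1 q.2) ≤ c := by
  have : 0 < p.P₀ * p.G r q.1 q.2 := mul_pos hp.P₀_pos (G_pos hp (hp.Rin_nonneg.trans hq.1.1))
  exact le_trans (mul_le_mul_of_nonneg_right hz this.le) hc

/-- On the closed strip `0 ≤ re z ≤ s(r)` the exponent of the reflected signal is bounded,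
uniformly in `r`. -/
theorem norm_expoRIS_le (hp : p.Admissible) {c r : ℝ}
    (hc1 : 2 * (p.M * p.varZ) * c < 1)
    (hc : ∀ q ∈ p.panelDomain, p.sVal r * (p.P₀ * p.G r q.1 q.2) ≤ c) {z : ℂ} (hz : z.re ≤ p.sVal r) :
    ‖p.expoRIS r z‖ ≤ p.Rout * (1 + p.reflBound c) * volume.real p.panelDomain := by
  have hle : ∀ q ∈ p.panelDomain, z.re * (p.P₀ * p.G r q.1 q.2) ≤ c := fun q hq =>
    re_mul_le_of_strip hp hq (hc q hq) hz
  rw [expoRIS_eq_integral_panelDomain hp fun q hq => lt_of_le_of_lt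
    (mul_le_mul_of_nonneg_left (hle q hq) (by positivity)) hc1]
  refine norm_setIntegral_le_of_norm_le_const isCompact_panelDomain.measure_lt_top fun q hq => ?_
  have h0 : 0 ≤ q.1 := hp.Rin_nonneg.trans hq.1.1
  rw [norm_mul, Complex.norm_real, Real.norm_of_nonneg h0]
  have h3 := norm_LR_neg_le (p := p) hc1 (w := z * ((p.P₀ * p.G r q.1 q.2 : ℝ) : ℂ))
    (by rw [Complex.re_mul_ofReal]; exact hle q hq)
  have h4 := norm_sub_le (1 : ℂ) (p.LR (-(z * ((p.P₀ * p.G r q.1 q.2 : ℝ) : ℂ))))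
  rw [norm_one] at h4
  exact mul_le_mul hq.1.2 (by linarith) (norm_nonneg _) (h0.trans hq.1.2)

theorem integral_id_mul_g_nonneg (hp : p.Admissible) : 0 ≤ ∫ x in Ioi (0 : ℝ), x * p.g x :=
  setIntegral_nonneg measurableSet_Ioi fun _ hx =>
    mul_nonneg (le_of_lt hx) (g_pos hp (le_of_lt hx)).le

theorem norm_expoBS_le (hp : p.Admissible) {r t : ℝ} (hr : 0 ≤ r) (ht : 0 < t) {z : ℂ}
    (hz : 0 ≤ z.re) :
    ‖p.expoBS r t z‖ ≤ 2 * Real.pi * (‖z‖ * (t * p.P₀) * ∫ x in Ioi (0 : ℝ), x * p.g x) := by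
  have hP := hp.P₀_pos
  have hi := integrableOn_id_mul_g hp le_rfl
  rw [expoBS, norm_mul]
  have h2 : ‖(2 : ℂ) * (Real.pi : ℂ)‖ = 2 * Real.pi := by
    rw [norm_mul, Complex.norm_real, Real.norm_of_nonneg Real.pi_pos.le]; simp
  rw [h2]
  refine mul_le_mul_of_nonneg_left ?_ Real.two_pi_pos.le
  have hsub : Ioi r ⊆ Ioi (0 : ℝ) := Ioi_subset_Ioi hr
  refine (norm_integral_le_of_norm_le ((hi.mono_set hsub).const_mul (‖z‖ * (t * p.P₀))) ?_).trans ?_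
  · filter_upwards [ae_restrict_mem measurableSet_Ioi] with x hx
    have hx0 : 0 < x := hsub hx
    have hgx := g_pos hp hx0.le
    have hre : 0 ≤ (z * ((t * p.P₀ * p.g x : ℝ) : ℂ)).re := by
      rw [Complex.re_mul_ofReal]; positivity
    rw [one_sub_LD (by linarith), norm_mul, Complex.norm_real, Real.norm_of_nonneg hx0.le]
    have h := norm_div_one_add_le hre
    rw [norm_mul z, Complex.norm_real, Real.norm_of_nonneg (by positivity)] at h
    calc _ ≤ x * (‖z‖ * (t * p.P₀ * p.g x)) := by gcongr
      _ = _ := by ring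
  · rw [integral_const_mul]
    refine mul_le_mul_of_nonneg_left ?_ (by positivity)
    refine setIntegral_mono_set hi ?_ hsub.eventuallyLE
    filter_upwards [ae_restrict_mem measurableSet_Ioi] with x hx
    exact mul_nonneg (le_of_lt hx) (g_pos hp (le_of_lt hx)).le

/-- The interference alone makes the transform decay: every interferer whose scaled mean power is
at least one contributes at least `1/4` to the real part of the exponent. -/
theorem le_re_expoBS (hp : p.Admissible) {r t : ℝ} (hr : 0 ≤ r) (ht : 0 < t) {z : ℂ}
    (hz : 0 ≤ z.re) :
    Real.pi / 4 * (max ((‖z‖ * (p.P₀ * p.g r) * t) ^ (1 / p.α) - 1) 0) ^ 2 ≤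
      (p.expoBS r t z).re := by
  have hP := hp.P₀_pos
  have hgr := g_pos hp hr
  have hα : 0 < p.α := by linarith [hp.two_lt_α]
  have hint := integrableOn_expoBS hp hr ht (z := z)
    (lt_of_lt_of_le (by norm_num) (by positivity : (0 : ℝ) ≤ z.re * (t * p.P₀ * p.g r)))
  have hre : (p.expoBS r t z).re = 2 * Real.pi *
      ∫ x in Ioi r, ((x : ℂ) * (1 - LD (z * ((t * p.P₀ * p.g x : ℝ) : ℂ)))).re := by
    have h1 : ((2 : ℂ) * (Real.pi : ℂ)) = ((2 * Real.pi : ℝ) : ℂ) := by push_cast; rfl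
    rw [expoBS, h1, Complex.re_ofReal_mul]
    congr 1
    exact (integral_re (𝕜 := ℂ) hint).symm
  have hw : ∀ x ∈ Ioi r, 0 ≤ (z * ((t * p.P₀ * p.g x : ℝ) : ℂ)).re := by
    intro x hx
    have := g_pos hp (hr.trans (le_of_lt hx))
    rw [Complex.re_mul_ofReal]; positivity
  have hval : ∀ x ∈ Ioi r, ((x : ℂ) * (1 - LD (z * ((t * p.P₀ * p.g x : ℝ) : ℂ)))).re =
      x * ((z * ((t * p.P₀ * p.g x : ℝ) : ℂ)) / (1 + z * ((t * p.P₀ * p.g x : ℝ) : ℂ))).re := by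
    intro x hx
    rw [one_sub_LD (by linarith [hw x hx]), Complex.re_ofReal_mul]
  have hnn : ∀ x ∈ Ioi r, 0 ≤ ((x : ℂ) * (1 - LD (z * ((t * p.P₀ * p.g x : ℝ) : ℂ)))).re := by
    intro x hx
    rw [hval x hx]
    exact mul_nonneg (hr.trans (le_of_lt hx)) (re_div_one_add_nonneg (hw x hx))
  have hintre : IntegrableOn (fun x : ℝ =>
    ((x : ℂ) * (1 - LD (z * ((t * p.P₀ * p.g x : ℝ) : ℂ)))).re) (Ioi r) := hint.re
  rw [hre]
  set y := ‖z‖ * (p.P₀ * p.g r) * t with hy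
  have hy0 : 0 ≤ y := by positivity
  set T := y ^ (1 / p.α) with hT
  rcases le_total T 1 with hT1 | hT1
  · rw [max_eq_right (by linarith)]
    have := setIntegral_nonneg (μ := volume) measurableSet_Ioi hnn
    have := Real.pi_pos
    simp only [ne_eq, OfNat.ofNat_ne_zero, not_false_eq_true, zero_pow, mul_zero]
    positivity
  rw [max_eq_left (by linarith)]
  -- the interferers at distance at most `X` have scaled mean power at least one
  set X := (r + 1) * T - 1 with hX
  have hrX : r ≤ X := by nlinarith
  have hlow : ∀ x ∈ Ioc r X, 1 / 4 * x ≤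
      ((x : ℂ) * (1 - LD (z * ((t * p.P₀ * p.g x : ℝ) : ℂ)))).re := by
    intro x hx
    have hx0 : 0 ≤ x := hr.trans hx.1.le
    have hgx := g_pos hp hx0
    rw [hval x hx.1, mul_comm]
    refine mul_le_mul_of_nonneg_left (quarter_le_re_div_one_add (hw x hx.1) ?_) hx0
    rw [norm_mul, Complex.norm_real, Real.norm_of_nonneg (by positivity)]
    have h1 : ‖z‖ * (t * p.P₀ * p.g x) = y * (p.g x / p.g r) := by
      rw [hy]; field_simp
    have hT0 : 0 < T := by linarith
    have hTy : T ^ p.α = y := by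
      rw [hT, ← Real.rpow_mul hy0, one_div_mul_cancel hα.ne', Real.rpow_one]
    rw [h1, g_div_g hp hr hx0, ← hTy, ← Real.mul_rpow hT0.le (by positivity)]
    refine Real.one_le_rpow ?_ hα.le
    rw [mul_div_assoc', le_div_iff₀ (by linarith)]
    linarith [hx.2]
  have h1 : ∫ x in Ioc r X, 1 / 4 * x ≤
      ∫ x in Ioi r, ((x : ℂ) * (1 - LD (z * ((t * p.P₀ * p.g x : ℝ) : ℂ)))).re := by
    refine (setIntegral_mono_on ?_ (hintre.mono_set Ioc_subset_Ioi_self) measurableSet_Ioc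
      hlow).trans (setIntegral_mono_set hintre ?_ Ioc_subset_Ioi_self.eventuallyLE)
    · exact (Continuous.integrableOn_Icc (by fun_prop)).mono_set Ioc_subset_Icc_self
    · filter_upwards [ae_restrict_mem measurableSet_Ioi] with x hx using hnn x hx
  have h2 : ∫ x in Ioc r X, 1 / 4 * x = (X ^ 2 - r ^ 2) / 8 := by
    rw [← intervalIntegral.integral_of_le hrX, intervalIntegral.integral_const_mul, integral_id]
    ring
  rw [h2] at h1
  have h3 : (T - 1) ^ 2 ≤ X ^ 2 - r ^ 2 := by
    have e : X ^ 2 - r ^ 2 = ((r + 1) * (T - 1)) * ((r + 1) * (T + 1) - 2) := by rw [hX]; ring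
    rw [e, sq]
    have : 0 ≤ T - 1 := by linarith
    refine mul_le_mul ?_ ?_ this (by positivity) <;> nlinarith
  have hpi := Real.pi_pos
  calc Real.pi / 4 * (T - 1) ^ 2 ≤ Real.pi / 4 * (X ^ 2 - r ^ 2) := by gcongr
    _ = 2 * Real.pi * ((X ^ 2 - r ^ 2) / 8) := by ring
    _ ≤ _ := by gcongr

theorem norm_expoBS_le_rpow (hp : p.Admissible) {r t : ℝ} (hr : 0 ≤ r) (ht : 0 < t) {z : ℂ}
    (hz : 0 ≤ z.re) :
    ‖p.expoBS r t z‖ ≤ 2 * Real.pi * (∫ x in Ioi (0 : ℝ), x * p.g x) / p.β * (r + 1) ^ p.α *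
      (‖z‖ * (p.P₀ * p.g r) * t) := by
  have hP := hp.P₀_pos
  have hβ := hp.β_pos
  have hr1 : 0 < r + 1 := by linarith
  have hs : p.g r * (r + 1) ^ p.α = p.β := by
    rw [g, mul_assoc, ← Real.rpow_add hr1, neg_add_cancel, Real.rpow_zero, mul_one]
  refine (norm_expoBS_le hp hr ht hz).trans (le_of_eq ?_)
  rw [div_mul_eq_mul_div, div_mul_eq_mul_div, eq_div_iff hβ.ne', ← hs]
  ring

/-- Quadratic decay of `B` in `|z| / s(r) * t`, with constants depending only on a positive lower
bound of the base station density and an upper bound of the modulus of the panel density. -/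
theorem norm_B_le (hp : p.Admissible) {b Λ E l lR r t : ℝ} (hb : 0 < b) (hl : b ≤ l)
    (hlR : |lR| ≤ Λ) (hr : 0 ≤ r) (ht : 0 < t) {z : ℂ} (hz : 0 ≤ z.re)
    (hER : ‖p.expoRIS r z‖ ≤ E) :
    ‖p.B l lR r t z‖ ≤ 4 * Real.exp (p.α ^ 2 / (b * (Real.pi / 4))) * Real.exp (Λ * E) /
      (1 + ‖z‖ * (p.P₀ * p.g r) * t) ^ 2 := by
  have hP := hp.P₀_pos
  have hgr := g_pos hp hr
  have hα : 0 < p.α := by linarith [hp.two_lt_α]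
  have hk : 0 < b * (Real.pi / 4) := by positivity
  have hN0 : 0 ≤ ‖z‖ * (p.P₀ * p.g r) * t := by positivity
  have h1 := exp_neg_sq_posPart_rpow_le hα hk hN0
  have hre := le_re_expoBS hp hr ht hz
  set N := ‖z‖ * (p.P₀ * p.g r) * t with hN
  rw [B, norm_mul, norm_mul, Complex.norm_exp, Complex.norm_exp, Complex.norm_exp]
  have h1' : Real.exp (-((l : ℂ) * p.expoBS r t z)).re ≤
      4 * Real.exp (p.α ^ 2 / (b * (Real.pi / 4))) / (1 + N) ^ 2 := by
    refine le_trans (Real.exp_le_exp.2 ?_) h1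
    rw [Complex.neg_re, Complex.re_ofReal_mul, neg_le_neg_iff, mul_assoc]
    exact mul_le_mul hl hre (by positivity) (by linarith)
  have h2 : Real.exp (-(z * ((t * p.noise : ℝ) : ℂ))).re ≤ 1 := by
    rw [Real.exp_le_one_iff, Complex.neg_re, Complex.re_mul_ofReal, neg_nonpos]
    exact mul_nonneg hz (mul_nonneg ht.le hp.noise_nonneg)
  have h3 : Real.exp (-((lR : ℂ) * p.expoRIS r z)).re ≤ Real.exp (Λ * E) := by
    apply Real.exp_le_exp.2
    refine (Complex.re_le_norm _).trans ?_
    rw [norm_neg, norm_mul, Complex.norm_real, Real.norm_eq_abs]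
    exact mul_le_mul hlR hER (norm_nonneg _) ((abs_nonneg _).trans hlR)
  calc _ ≤ 4 * Real.exp (p.α ^ 2 / (b * (Real.pi / 4))) / (1 + N) ^ 2 * 1
        * Real.exp (Λ * E) :=
        mul_le_mul (mul_le_mul h1' h2 (Real.exp_pos _).le (by positivity)) h3
          (Real.exp_pos _).le (by positivity)
    _ = _ := by ring

/-- Common bound for the transform and its derivatives on the strip `0 ≤ re z ≤ s(r)`. The
denominator is `1 + |z| / s(r) * t`, since `P₀ g(r) = 1 / s(r)`. -/
def stripBound (p : RISNetwork) (C r t : ℝ) (z : ℂ) : ℝ :=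
  C * (r + 1) ^ p.α / (1 + ‖z‖ * (p.P₀ * p.g r) * t)

/-- Bounds on the closed strip `0 ≤ re z ≤ s(r)`, uniform in `r`, `t` and locally uniform in the
densities. -/
theorem exists_stripBound (hp : p.Admissible)
    (hroc : ∀ r, p.Rc ≤ r → ∀ t : ℝ, 0 < t → p.sArg r ∈ p.roc r t) {b Λ : ℝ} (hb : 0 < b) :
    ∃ C : ℝ, 0 ≤ C ∧ ∀ l, b ≤ l → ∀ lR, |lR| ≤ Λ → ∀ r, p.Rc ≤ r → ∀ t, 0 < t → ∀ z : ℂ,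
      0 ≤ z.re → z.re ≤ p.sVal r →
      ‖p.B l lR r t z‖ ≤ p.stripBound C r t z ∧
      ‖p.dB_BS l lR r t z‖ ≤ p.stripBound C r t z ∧
      ‖p.dB_RIS l lR r t z‖ ≤ p.stripBound C r t z := by
  obtain ⟨c, hc0, hc1, hc⟩ := exists_uniform_exponent hp hroc
  have hRout : 0 ≤ p.Rout := hp.Rin_nonneg.trans hp.Rin_lt_Rout.le
  obtain ⟨E, hE, hE0⟩ : ∃ E, E = p.Rout * (1 + p.reflBound c) * volume.real p.panelDomain ∧ 0 ≤ E := by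
    have := reflBound_nonneg (p := p) c
    exact ⟨_, rfl, by positivity⟩
  obtain ⟨A, hA, hA0⟩ : ∃ A, A = 4 * Real.exp (p.α ^ 2 / (b * (Real.pi / 4))) * Real.exp (Λ * E) ∧
    0 ≤ A := ⟨_, rfl, by positivity⟩
  have hP := hp.P₀_pos
  have hβ := hp.β_pos
  obtain ⟨D, hD, hD0⟩ : ∃ D, D = 2 * Real.pi * (∫ x in Ioi (0 : ℝ), x * p.g x) / p.β ∧ 0 ≤ D := by
    have := integral_id_mul_g_nonneg hp
    exact ⟨_, rfl, by positivity⟩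
  refine ⟨A * (1 + D + E), by positivity, ?_⟩
  intro l hl lR hlR r hr t ht z hz0 hz1
  have hr0 : 0 ≤ r := hp.Rc_nonneg.trans hr
  have hgr := g_pos hp hr0
  have hER : ‖p.expoRIS r z‖ ≤ E := by
    rw [hE]; exact norm_expoRIS_le hp hc1 (hc r hr) hz1
  have hEB := norm_expoBS_le_rpow hp hr0 ht hz0
  have hB := norm_B_le hp hb hl hlR hr0 ht hz0 hER
  rw [dB_BS, dB_RIS, norm_neg, norm_neg, norm_mul, norm_mul, stripBound]
  rw [← hD] at hEB
  rw [← hA] at hB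
  have hN0 : 0 ≤ ‖z‖ * (p.P₀ * p.g r) * t := by positivity
  have hρ1 : 1 ≤ (r + 1) ^ p.α := Real.one_le_rpow (by linarith) (by linarith [hp.two_lt_α])
  have hBn := norm_nonneg (p.B l lR r t z)
  have hEn := norm_nonneg (p.expoBS r t z)
  have hRn := norm_nonneg (p.expoRIS r z)
  generalize ‖z‖ * (p.P₀ * p.g r) * t = N at *
  generalize (r + 1) ^ p.α = ρ at *
  generalize ‖p.B l lR r t z‖ = nB at *
  generalize ‖p.expoBS r t z‖ = nE at *
  generalize ‖p.expoRIS r z‖ = nR at *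
  clear hE hA hD
  have hN1 : 0 < 1 + N := by linarith
  have hB' : nB * (1 + N) ^ 2 ≤ A := by rwa [le_div_iff₀ (by positivity)] at hB
  have hB1 : nB * (1 + N) ≤ A := by
    refine le_trans ?_ hB'
    exact mul_le_mul_of_nonneg_left (by nlinarith) hBn
  have hρ0 : 0 ≤ ρ := by linarith
  rw [le_div_iff₀ hN1, le_div_iff₀ hN1, le_div_iff₀ hN1]
  refine ⟨?_, ?_, ?_⟩
  · refine hB1.trans ?_
    rw [mul_assoc]
    exact le_mul_of_one_le_right hA0 (by nlinarith)
  · calc nB * nE * (1 + N) ≤ nB * (D * ρ * N) * (1 + N) := by gcongr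
      _ = nB * (N * (1 + N)) * (D * ρ) := by ring
      _ ≤ nB * (1 + N) ^ 2 * (D * ρ) := by gcongr; nlinarith
      _ ≤ A * (D * ρ) := by gcongr
      _ ≤ A * ((1 + D + E) * ρ) := by gcongr; linarith
      _ = _ := by ring
  · calc nB * nR * (1 + N) = nB * (1 + N) * nR := by ring
      _ ≤ A * E := by gcongr
      _ ≤ A * ((1 + D + E) * ρ) := mul_le_mul_of_nonneg_left (by nlinarith) hA0
      _ = _ := by ring

end RISNetwork

/-! ### Domination for the iterated integrals -/

theorem lineWeight_nonneg (v : ℝ) : 0 ≤ lineWeight v := by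
  have := Real.pi_pos
  unfold lineWeight
  positivity

@[fun_prop]
theorem measurable_lineWeight : Measurable lineWeight := by
  unfold lineWeight
  fun_prop

theorem integrable_lineWeight : Integrable lineWeight := by
  refine (integrable_inv_one_add_sq.const_mul 4).mono' (by fun_prop)
    (Eventually.of_forall fun v => ?_)
  rw [Real.norm_of_nonneg (lineWeight_nonneg v), lineWeight, ← one_div, mul_one_div,
    div_le_div_iff₀ (by have := Real.pi_pos; positivity) (by positivity)]
  nlinarith [Real.pi_gt_three, sq_nonneg v]

/-- Differentiation of a weighted integral under a bound that is uniform on a neighbourhood. -/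
theorem hasDerivAt_integral_mul_lineWeight {F F' : ℝ → ℝ → ℂ} {s : Set ℝ} {W l : ℝ} (hs : s ∈ 𝓝 l)
    (hF : ∀ x ∈ s, Measurable (F x)) (hF' : Measurable (F' l))
    (hb : ∀ x ∈ s, ∀ v, ‖F x v‖ ≤ W) (hb' : ∀ x ∈ s, ∀ v, ‖F' x v‖ ≤ W)
    (hd : ∀ x ∈ s, ∀ v, HasDerivAt (fun x => F x v) (F' x v) x) :
    HasDerivAt (fun x => ∫ v, F x v * (lineWeight v : ℂ)) (∫ v, F' l v * (lineWeight v : ℂ)) l := by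
  have hn : ∀ (f : ℝ → ℂ) v, ‖f v‖ ≤ W → ‖f v * (lineWeight v : ℂ)‖ ≤ W * lineWeight v := by
    intro f v h
    rw [norm_mul, Complex.norm_real, Real.norm_of_nonneg (lineWeight_nonneg v)]
    exact mul_le_mul_of_nonneg_right h (lineWeight_nonneg v)
  refine (hasDerivAt_integral_of_dominated_loc_of_deriv_le (s := s)
    (F' := fun x v => F' x v * (lineWeight v : ℂ)) (bound := fun v => W * lineWeight v)
    hs ?_ ?_ ?_ ?_ (integrable_lineWeight.const_mul W) ?_).2
  · filter_upwards [hs] with x hx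
    have := hF x hx
    exact Measurable.aestronglyMeasurable (by fun_prop)
  · have := hF l (mem_of_mem_nhds hs)
    exact (integrable_lineWeight.const_mul W).mono' (Measurable.aestronglyMeasurable (by fun_prop))
      (Eventually.of_forall fun v => hn _ v (hb l (mem_of_mem_nhds hs) v))
  · exact Measurable.aestronglyMeasurable (by fun_prop)
  · exact Eventually.of_forall fun v x hx => hn _ v (hb' x hx v)
  · exact Eventually.of_forall fun v x hx => (hd x hx v).mul_const _

theorem norm_integral_mul_lineWeight_le {f : ℝ → ℂ} {W : ℝ} (hb : ∀ v, ‖f v‖ ≤ W) :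
    ‖∫ v, f v * (lineWeight v : ℂ)‖ ≤ W * ∫ v, lineWeight v := by
  rw [← integral_const_mul]
  refine norm_integral_le_of_norm_le (integrable_lineWeight.const_mul W)
    (Eventually.of_forall fun v => ?_)
  rw [norm_mul, Complex.norm_real, Real.norm_of_nonneg (lineWeight_nonneg v)]
  exact mul_le_mul_of_nonneg_right (hb v) (lineWeight_nonneg v)

theorem integrableOn_one_div_one_add_sq : IntegrableOn (fun t : ℝ => 1 / (1 + t) ^ 2) (Ioi 0) := by
  have h := integrableOn_add_rpow_Ioi_of_lt (a := -2) (c := 0) (m := 1) (by norm_num) (by norm_num)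
  refine h.congr_fun (fun t ht => ?_) measurableSet_Ioi
  have ht0 : (0 : ℝ) < t := ht
  dsimp only
  rw [Real.rpow_neg (by positivity), Real.rpow_two, add_comm, one_div]

/-- Differentiation under a double integral `∫ (∫ Φ dr) dt / (1 + t)` when the integrand and its
derivative are dominated by `D r / (1 + t)`. The measurability hypotheses ask only for a jointly
measurable function that agrees with the integrand on the domain of integration. -/
theorem hasDerivAt_iterated_integral {Φ Φ' : ℝ → ℝ → ℝ → ℂ} {s : Set ℝ} {l a : ℝ} {D : ℝ → ℝ}
    (hs : s ∈ 𝓝 l) (hD : IntegrableOn D (Ioi a))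
    (hm : ∀ x ∈ s, ∃ Ψ : ℝ × ℝ → ℂ, Measurable Ψ ∧ ∀ t > 0, ∀ r > a, Φ x t r = Ψ (t, r))
    (hb : ∀ x ∈ s, ∀ t > 0, ∀ r > a, ‖Φ x t r‖ ≤ D r / (1 + t))
    (hb' : ∀ x ∈ s, ∀ t > 0, ∀ r > a, ‖Φ' x t r‖ ≤ D r / (1 + t))
    (hd : ∀ x ∈ s, ∀ t > 0, ∀ r > a, HasDerivAt (fun x => Φ x t r) (Φ' x t r) x)
    (hm' : ∀ x ∈ s, ∃ Ψ : ℝ × ℝ → ℂ, Measurable Ψ ∧ ∀ t > 0, ∀ r > a, Φ' x t r = Ψ (t, r)) :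
    (∀ t > 0, IntegrableOn (Φ l t) (Ioi a) ∧ IntegrableOn (Φ' l t) (Ioi a) ∧
      HasDerivAt (fun x => ∫ r in Ioi a, Φ x t r) (∫ r in Ioi a, Φ' l t r) l) ∧
    IntegrableOn (fun t : ℝ => (∫ r in Ioi a, Φ l t r) * ((1 / (1 + t) : ℝ) : ℂ)) (Ioi 0) ∧
    IntegrableOn (fun t : ℝ => (∫ r in Ioi a, Φ' l t r) * ((1 / (1 + t) : ℝ) : ℂ)) (Ioi 0) ∧
    HasDerivAt (fun x => ∫ t in Ioi (0 : ℝ), (∫ r in Ioi a, Φ x t r) * ((1 / (1 + t) : ℝ) : ℂ))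
      (∫ t in Ioi (0 : ℝ), (∫ r in Ioi a, Φ' l t r) * ((1 / (1 + t) : ℝ) : ℂ)) l := by
  have hl : l ∈ s := mem_of_mem_nhds hs
  -- consequences of joint measurability and domination, for the integrand and its derivative alike
  have hmeasr : ∀ f : ℝ → ℝ → ℂ, (∃ Ψ : ℝ × ℝ → ℂ, Measurable Ψ ∧
      ∀ t > 0, ∀ r > a, f t r = Ψ (t, r)) → ∀ t > 0,
      AEStronglyMeasurable (f t) (volume.restrict (Ioi a)) := by
    rintro f ⟨Ψ, hΨ, he⟩ t ht
    refine AEStronglyMeasurable.congr (f := fun r => Ψ (t, r))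
      (by fun_prop : Measurable fun r => Ψ (t, r)).aestronglyMeasurable ?_
    filter_upwards [ae_restrict_mem measurableSet_Ioi] with r hr using (he t ht r hr).symm
  have hmeast : ∀ f : ℝ → ℝ → ℂ, (∃ Ψ : ℝ × ℝ → ℂ, Measurable Ψ ∧
      ∀ t > 0, ∀ r > a, f t r = Ψ (t, r)) →
      AEStronglyMeasurable (fun t : ℝ => (∫ r in Ioi a, f t r) * ((1 / (1 + t) : ℝ) : ℂ))
        (volume.restrict (Ioi 0)) := by
    rintro f ⟨Ψ, hΨ, he⟩
    have h1 : Measurable fun t : ℝ => ∫ r in Ioi a, Ψ (t, r) :=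
      (hΨ.stronglyMeasurable.integral_prod_right' (ν := volume.restrict (Ioi a))).measurable
    refine AEStronglyMeasurable.congr
      (f := fun t : ℝ => (∫ r in Ioi a, Ψ (t, r)) * ((1 / (1 + t) : ℝ) : ℂ))
      (by fun_prop : Measurable _).aestronglyMeasurable ?_
    filter_upwards [ae_restrict_mem measurableSet_Ioi] with t ht
    congr 1
    exact setIntegral_congr_fun measurableSet_Ioi fun r hr => (he t ht r hr).symm
  have hint : ∀ f : ℝ → ℝ → ℂ, (∃ Ψ : ℝ × ℝ → ℂ, Measurable Ψ ∧
      ∀ t > 0, ∀ r > a, f t r = Ψ (t, r)) → (∀ t > 0, ∀ r > a, ‖f t r‖ ≤ D r / (1 + t)) →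
      ∀ t > 0, IntegrableOn (f t) (Ioi a) := by
    intro f h1 h2 t ht
    refine (hD.div_const (1 + t)).mono' (hmeasr f h1 t ht) ?_
    filter_upwards [ae_restrict_mem measurableSet_Ioi] with r hr using h2 t ht r hr
  have hnorm : ∀ f : ℝ → ℝ → ℂ, (∀ t > 0, ∀ r > a, ‖f t r‖ ≤ D r / (1 + t)) → ∀ t > 0,
      ‖(∫ r in Ioi a, f t r) * ((1 / (1 + t) : ℝ) : ℂ)‖ ≤
        (∫ r in Ioi a, D r) * (1 / (1 + t) ^ 2) := by
    intro f h2 t ht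
    have h3 : ‖∫ r in Ioi a, f t r‖ ≤ (∫ r in Ioi a, D r) / (1 + t) := by
      rw [← integral_div]
      refine norm_integral_le_of_norm_le (hD.div_const (1 + t)) ?_
      filter_upwards [ae_restrict_mem measurableSet_Ioi] with r hr using h2 t ht r hr
    have ht1 : 0 < 1 + t := by linarith
    rw [norm_mul, Complex.norm_real, Real.norm_of_nonneg (by positivity)]
    calc _ ≤ (∫ r in Ioi a, D r) / (1 + t) * (1 / (1 + t)) := by gcongr
      _ = _ := by field_simp
  have hdr : ∀ x ∈ interior s, ∀ t > 0, HasDerivAt (fun x => ∫ r in Ioi a, Φ x t r)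
      (∫ r in Ioi a, Φ' x t r) x := by
    intro x hx t ht
    have hxs : s ∈ 𝓝 x := mem_interior_iff_mem_nhds.1 hx
    have hx' : x ∈ s := interior_subset hx
    refine (hasDerivAt_integral_of_dominated_loc_of_deriv_le (s := s)
      (μ := volume.restrict (Ioi a)) (F := fun x r => Φ x t r)
      (F' := fun x r => Φ' x t r) (bound := fun r => D r / (1 + t)) hxs ?_
      (hint _ (hm x hx') (hb x hx') t ht) (hmeasr _ (hm' x hx') t ht) ?_ (hD.div_const _) ?_).2
    · filter_upwards [hxs] with y hy using hmeasr _ (hm y hy) t ht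
    · filter_upwards [ae_restrict_mem measurableSet_Ioi] with r hr y hy using hb' y hy t ht r hr
    · filter_upwards [ae_restrict_mem measurableSet_Ioi] with r hr y hy using hd y hy t ht r hr
  have hT : ∀ f : ℝ → ℝ → ℂ, (∃ Ψ : ℝ × ℝ → ℂ, Measurable Ψ ∧
      ∀ t > 0, ∀ r > a, f t r = Ψ (t, r)) → (∀ t > 0, ∀ r > a, ‖f t r‖ ≤ D r / (1 + t)) →
      IntegrableOn (fun t : ℝ => (∫ r in Ioi a, f t r) * ((1 / (1 + t) : ℝ) : ℂ)) (Ioi 0) := by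
    intro f h1 h2
    refine (integrableOn_one_div_one_add_sq.const_mul (∫ r in Ioi a, D r)).mono' (hmeast f h1) ?_
    filter_upwards [ae_restrict_mem measurableSet_Ioi] with t ht using hnorm f h2 t ht
  have hli : l ∈ interior s := mem_interior_iff_mem_nhds.2 hs
  refine ⟨fun t ht => ⟨hint _ (hm l hl) (hb l hl) t ht, hint _ (hm' l hl) (hb' l hl) t ht,
    hdr l hli t ht⟩, hT _ (hm l hl) (hb l hl), hT _ (hm' l hl) (hb' l hl), ?_⟩
  refine (hasDerivAt_integral_of_dominated_loc_of_deriv_le (s := interior s)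
    (μ := volume.restrict (Ioi 0))
    (F := fun x t => (∫ r in Ioi a, Φ x t r) * ((1 / (1 + t) : ℝ) : ℂ))
    (F' := fun x t => (∫ r in Ioi a, Φ' x t r) * ((1 / (1 + t) : ℝ) : ℂ))
    (bound := fun t => (∫ r in Ioi a, D r) * (1 / (1 + t) ^ 2)) (isOpen_interior.mem_nhds hli) ?_
    (hT _ (hm l hl) (hb l hl)) (hmeast _ (hm' l hl)) ?_
    (integrableOn_one_div_one_add_sq.const_mul _) ?_).2
  · filter_upwards [hs] with y hy using hmeast _ (hm y hy)
  · filter_upwards [ae_restrict_mem measurableSet_Ioi] with t ht y hy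
    exact hnorm _ (hb' y (interior_subset hy)) t ht
  · filter_upwards [ae_restrict_mem measurableSet_Ioi] with t ht y hy
    exact (hdr y hy t ht).mul_const _

/-- Polynomial factors are absorbed by half of the Gaussian density of the serving distance. -/
theorem exists_gaussian_bound {α b b' : ℝ} (hα : 0 < α) (hb : 0 < b) (hb' : 0 < b') :
    ∃ K : ℝ, 0 ≤ K ∧ ∀ r : ℝ, 0 ≤ r →
      (r + 1) ^ α * ((b' + 1 + Real.pi * r ^ 2 * b') * (2 * Real.pi * r)) *
        Real.exp (-(Real.pi * r ^ 2 * b)) ≤ K * Real.exp (-(Real.pi * b / 2) * r ^ 2) := by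
  have hpi := Real.pi_pos
  refine ⟨(b' + 1 + 2 * Real.pi * b') * (2 * Real.pi) *
    Real.exp ((α + 2) ^ 2 / (2 * (Real.pi * b))), by positivity, fun r hr => ?_⟩
  have h1 : (r + 1) ^ α ≤ Real.exp (α * r) := by
    rw [mul_comm, Real.exp_mul]
    exact Real.rpow_le_rpow (by positivity) (Real.add_one_le_exp r) hα.le
  have hq := Real.quadratic_le_exp_of_nonneg hr
  have h2 : r ≤ Real.exp r := by nlinarith [sq_nonneg r]
  have h3 : b' + 1 + Real.pi * r ^ 2 * b' ≤ (b' + 1 + 2 * Real.pi * b') * Real.exp r := by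
    have e1 : (1 : ℝ) ≤ Real.exp r := Real.one_le_exp hr
    have e2 : r ^ 2 ≤ 2 * Real.exp r := by nlinarith
    have e3 : Real.pi * b' * r ^ 2 ≤ Real.pi * b' * (2 * Real.exp r) :=
      mul_le_mul_of_nonneg_left e2 (by positivity)
    nlinarith
  have h4 : (α + 2) * r - Real.pi * r ^ 2 * b ≤
      (α + 2) ^ 2 / (2 * (Real.pi * b)) + -(Real.pi * b / 2) * r ^ 2 := by
    have hpb : 0 < Real.pi * b := by positivity
    have : (α + 2) * r ≤ (α + 2) ^ 2 / (2 * (Real.pi * b)) + (Real.pi * b / 2) * r ^ 2 := by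
      rw [← sub_nonneg]
      have e : (α + 2) ^ 2 / (2 * (Real.pi * b)) + (Real.pi * b / 2) * r ^ 2 - (α + 2) * r =
          ((α + 2) - Real.pi * b * r) ^ 2 / (2 * (Real.pi * b)) := by field_simp; ring
      rw [e]; positivity
    nlinarith
  calc _ ≤ Real.exp (α * r) * (((b' + 1 + 2 * Real.pi * b') * Real.exp r) *
          (2 * Real.pi * Real.exp r)) * Real.exp (-(Real.pi * r ^ 2 * b)) := by gcongr
    _ = (b' + 1 + 2 * Real.pi * b') * (2 * Real.pi) *
          Real.exp ((α + 2) * r - Real.pi * r ^ 2 * b) := by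
        have : Real.exp ((α + 2) * r - Real.pi * r ^ 2 * b) = Real.exp (α * r) * Real.exp r *
            Real.exp r * Real.exp (-(Real.pi * r ^ 2 * b)) := by
          rw [← Real.exp_add, ← Real.exp_add, ← Real.exp_add]; ring_nf
        rw [this]; ring
    _ ≤ (b' + 1 + 2 * Real.pi * b') * (2 * Real.pi) *
          Real.exp ((α + 2) ^ 2 / (2 * (Real.pi * b)) + -(Real.pi * b / 2) * r ^ 2) := by gcongr
    _ = _ := by rw [Real.exp_add]; ring

/-! ### The middle line of the strip -/

namespace RISNetwork

variable {p : RISNetwork}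

/-- The point of the middle line of the strip `0 ≤ re z ≤ s(r)` at scaled height `v`. -/
def midPt (p : RISNetwork) (r v : ℝ) : ℂ := p.sVal r * (1 / 2 + v * Complex.I)

theorem midPt_re (r v : ℝ) : (p.midPt r v).re = p.sVal r / 2 := by
  rw [midPt, Complex.re_ofReal_mul]
  simp
  ring

theorem midPt_neg (r v : ℝ) : p.midPt r (-v) = starRingEnd ℂ (p.midPt r v) := by
  simp only [midPt, map_mul, map_add, Complex.conj_ofReal, Complex.conj_I, map_div₀, map_one,
    map_ofNat]
  push_cast
  ring

@[fun_prop]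
theorem measurable_sVal : Measurable p.sVal := by
  unfold sVal
  fun_prop

@[fun_prop]
theorem measurable_midPt : Measurable (fun q : ℝ × ℝ => p.midPt q.1 q.2) := by
  unfold midPt
  fun_prop

/-- Weighted average of `F` over the middle line of the strip. -/
def lineAvg (p : RISNetwork) (F : ℂ → ℂ) (r : ℝ) : ℂ :=
  ∫ v : ℝ, F (p.midPt r v) * (lineWeight v : ℂ)

theorem stripBound_midPt_le (hp : p.Admissible) {C r t : ℝ} (hC : 0 ≤ C) (hr : 0 ≤ r) (ht : 0 < t)
    (v : ℝ) : p.stripBound C r t (p.midPt r v) ≤ 2 * C * (r + 1) ^ p.α / (1 + t) := by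
  have hP := hp.P₀_pos
  have hgr := g_pos hp hr
  have h1 : 1 / 2 ≤ ‖(1 / 2 : ℂ) + v * Complex.I‖ := by
    refine le_trans ?_ (Complex.re_le_norm _)
    simp
  have h2 : ‖p.midPt r v‖ * (p.P₀ * p.g r) = ‖(1 / 2 : ℂ) + v * Complex.I‖ := by
    rw [midPt, norm_mul, Complex.norm_real, Real.norm_of_nonneg (sVal_pos hp hr).le, sVal]
    field_simp
  have hρ : 0 ≤ (r + 1) ^ p.α := Real.rpow_nonneg (by linarith) _
  rw [stripBound, h2, div_le_div_iff₀ (by positivity) (by positivity)]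
  have : 1 + t ≤ 2 * (1 + ‖(1 / 2 : ℂ) + v * Complex.I‖ * t) := by nlinarith
  calc C * (r + 1) ^ p.α * (1 + t)
      ≤ C * (r + 1) ^ p.α * (2 * (1 + ‖(1 / 2 : ℂ) + v * Complex.I‖ * t)) := by gcongr
    _ = _ := by ring

theorem expoBS_zero (r t : ℝ) : p.expoBS r t 0 = 0 := by
  have : LD 0 = 1 := by rw [LD_eq (by simp)]; simp
  simp [expoBS, this]

theorem expoRIS_zero (r : ℝ) : p.expoRIS r 0 = 0 := by
  have : p.LR 0 = 1 := by simp [LR, complexMGF]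
  simp [expoRIS, this]

theorem B_zero (lB lR r t : ℝ) : p.B lB lR r t 0 = 1 := by
  simp [B, expoBS_zero, expoRIS_zero]

theorem dB_BS_zero (lB lR r t : ℝ) : p.dB_BS lB lR r t 0 = 0 := by
  simp [dB_BS, expoBS_zero]

theorem dB_RIS_zero (lB lR r t : ℝ) : p.dB_RIS lB lR r t 0 = 0 := by
  simp [dB_RIS, expoRIS_zero]

theorem hasDerivAt_neg_ofReal_mul (e : ℂ) (x : ℝ) :
    HasDerivAt (fun l : ℝ => -((l : ℂ) * e)) (-e) x := by
  simpa using ((Complex.ofRealCLM.hasDerivAt (x := x)).mul_const e).fun_neg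

theorem hasDerivAt_B_BS (lB lR r t : ℝ) (z : ℂ) :
    HasDerivAt (fun l : ℝ => p.B l lR r t z) (p.dB_BS lB lR r t z) lB := by
  have h1 := hasDerivAt_neg_ofReal_mul (p.expoBS r t z) lB
  refine ((h1.cexp.mul_const _).mul_const _).congr_deriv ?_
  rw [dB_BS, B]; ring

theorem hasDerivAt_B_RIS (lB lR r t : ℝ) (z : ℂ) :
    HasDerivAt (fun l : ℝ => p.B lB l r t z) (p.dB_RIS lB lR r t z) lR := by
  have h1 := hasDerivAt_neg_ofReal_mul (p.expoRIS r z) lR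
  refine (h1.cexp.const_mul _).congr_deriv ?_
  rw [dB_RIS, B]; ring

theorem measurable_B_midPt (hp : p.Admissible) (lB lR : ℝ) :
    Measurable (fun q : (ℝ × ℝ) × ℝ => p.B lB lR q.1.2 q.1.1 (p.midPt q.1.2 q.2)) := by
  have h1 : Measurable (fun q : (ℝ × ℝ) × ℝ => p.expoBS q.1.2 q.1.1 (p.midPt q.1.2 q.2)) :=
    measurable_expoBS.comp (g := fun q : ℝ × ℝ × ℂ => p.expoBS q.1 q.2.1 q.2.2)
      (f := fun q : (ℝ × ℝ) × ℝ => (q.1.2, q.1.1, p.midPt q.1.2 q.2)) (by fun_prop)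
  have h2 : Measurable (fun q : (ℝ × ℝ) × ℝ => p.expoRIS q.1.2 (p.midPt q.1.2 q.2)) :=
    (measurable_expoRIS hp).comp (g := fun q : ℝ × ℂ => p.expoRIS q.1 q.2)
      (f := fun q : (ℝ × ℝ) × ℝ => (q.1.2, p.midPt q.1.2 q.2)) (by fun_prop)
  unfold B
  fun_prop

theorem measurable_dB_BS_midPt (hp : p.Admissible) (lB lR : ℝ) :
    Measurable (fun q : (ℝ × ℝ) × ℝ => p.dB_BS lB lR q.1.2 q.1.1 (p.midPt q.1.2 q.2)) := by
  have h1 : Measurable (fun q : (ℝ × ℝ) × ℝ => p.expoBS q.1.2 q.1.1 (p.midPt q.1.2 q.2)) :=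
    measurable_expoBS.comp (g := fun q : ℝ × ℝ × ℂ => p.expoBS q.1 q.2.1 q.2.2)
      (f := fun q : (ℝ × ℝ) × ℝ => (q.1.2, q.1.1, p.midPt q.1.2 q.2)) (by fun_prop)
  exact ((measurable_B_midPt hp lB lR).mul h1).neg

theorem measurable_dB_RIS_midPt (hp : p.Admissible) (lB lR : ℝ) :
    Measurable (fun q : (ℝ × ℝ) × ℝ => p.dB_RIS lB lR q.1.2 q.1.1 (p.midPt q.1.2 q.2)) := by
  have h2 : Measurable (fun q : (ℝ × ℝ) × ℝ => p.expoRIS q.1.2 (p.midPt q.1.2 q.2)) :=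
    (measurable_expoRIS hp).comp (g := fun q : ℝ × ℂ => p.expoRIS q.1 q.2)
      (f := fun q : (ℝ × ℝ) × ℝ => (q.1.2, p.midPt q.1.2 q.2)) (by fun_prop)
  exact ((measurable_B_midPt hp lB lR).mul h2).neg

theorem measurable_lineAvg {F : ℝ → ℝ → ℂ → ℂ}
    (hF : Measurable (fun q : (ℝ × ℝ) × ℝ => F q.1.2 q.1.1 (p.midPt q.1.2 q.2))) :
    Measurable (fun q : ℝ × ℝ => p.lineAvg (F q.2 q.1) q.2) := by
  have h : Measurable (fun q : (ℝ × ℝ) × ℝ =>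
      F q.1.2 q.1.1 (p.midPt q.1.2 q.2) * (lineWeight q.2 : ℂ)) := hF.mul (by fun_prop)
  exact h.stronglyMeasurable.integral_prod_right'.measurable

/-- Both exponents are holomorphic on the closed strip `0 ≤ re z ≤ s(r)`, and so are `B` and its
derivatives in the densities. -/
theorem differentiableAt_strip (hp : p.Admissible)
    (hroc : ∀ r, p.Rc ≤ r → ∀ t : ℝ, 0 < t → p.sArg r ∈ p.roc r t) {r t : ℝ} (hr : p.Rc ≤ r)
    (ht : 0 < t) {z : ℂ} (hz0 : 0 ≤ z.re) (hz1 : z.re ≤ p.sVal r) :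
    DifferentiableAt ℂ (p.expoBS r t) z ∧ DifferentiableAt ℂ (p.expoRIS r) z := by
  obtain ⟨c, -, hc1, hc⟩ := exists_uniform_exponent hp hroc
  have hr0 := hp.Rc_nonneg.trans hr
  have hP := hp.P₀_pos
  have hgr := g_pos hp hr0
  refine ⟨differentiableAt_expoBS hp hr0 ht
    (lt_of_lt_of_le (by norm_num) (by positivity : (0 : ℝ) ≤ z.re * (t * p.P₀ * p.g r))),
    differentiableAt_expoRIS hp fun q hq => lt_of_le_of_lt (mul_le_mul_of_nonneg_left
      (re_mul_le_of_strip hp hq (hc r hr q hq) hz1) (by positivity)) hc1⟩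

theorem differentiableAt_B {lB lR r t : ℝ} {z : ℂ} (h1 : DifferentiableAt ℂ (p.expoBS r t) z)
    (h2 : DifferentiableAt ℂ (p.expoRIS r) z) : DifferentiableAt ℂ (p.B lB lR r t) z := by
  unfold B
  fun_prop

theorem pv_of_stripBound (hp : p.Admissible) {F : ℂ → ℂ} {C r t : ℝ} (hC : 0 ≤ C) (hr : 0 ≤ r)
    (ht : 0 < t) (hd : ∀ z : ℂ, 0 ≤ z.re → z.re ≤ p.sVal r → DifferentiableAt ℂ F z)
    (hb : ∀ z : ℂ, 0 ≤ z.re → z.re ≤ p.sVal r → ‖F z‖ ≤ p.stripBound C r t z) :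
    PVConverges (pvNum F (p.sArg r)) ∧ pvIntegral (pvNum F (p.sArg r)) =
      Complex.I * (2 * Real.pi * p.lineAvg F r - Real.pi * (F 0 + F (p.sArg r))) := by
  have hP := hp.P₀_pos
  have hgr := g_pos hp hr
  have ha : 0 < p.P₀ * p.g r * t := by positivity
  set m := min 1 (p.P₀ * p.g r * t) with hm
  have hm0 : 0 < m := lt_min one_pos ha
  have hρ : 0 ≤ (r + 1) ^ p.α := Real.rpow_nonneg (by linarith) _
  rw [sArg_eq]
  refine pv_strip (K := C * (r + 1) ^ p.α / m) (sVal_pos hp hr) hd fun z h0 h1 => ?_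
  refine (hb z h0 h1).trans ?_
  rw [stripBound, div_div]
  refine div_le_div_of_nonneg_left (by positivity) (by positivity) ?_
  have h2 := Complex.abs_im_le_norm z
  have h3 : m ≤ 1 := min_le_left _ _
  have h4 : m ≤ p.P₀ * p.g r * t := min_le_right _ _
  have h5 : m * |z.im| ≤ p.P₀ * p.g r * t * ‖z‖ := mul_le_mul h4 h2 (abs_nonneg _) ha.le
  nlinarith

theorem lineAvg_conj {F : ℂ → ℂ} (hF : ∀ z, F (starRingEnd ℂ z) = starRingEnd ℂ (F z)) (r : ℝ) :
    starRingEnd ℂ (p.lineAvg F r) = p.lineAvg F r := by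
  rw [lineAvg, ← integral_conj, ← integral_neg_eq_self]
  congr 1; ext v
  have hw : lineWeight (-v) = lineWeight v := by simp [lineWeight]
  rw [midPt_neg, hF, map_mul, Complex.conj_ofReal, hw, Complex.conj_conj]

/-! ### The coverage formula and the rate densities -/

/-- The principal values of `B` and of its derivatives converge and are averages over the middle line
minus half residues; the derivatives vanish at `0` because `B` equals one there. -/
theorem pv_formulas (hp : p.Admissible)
    (hroc : ∀ r, p.Rc ≤ r → ∀ t : ℝ, 0 < t → p.sArg r ∈ p.roc r t) {lB : ℝ} (hB : 0 < lB) (lR : ℝ)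
    {r t : ℝ} (hr : p.Rc ≤ r) (ht : 0 < t) :
    (PVConverges (pvNum (p.B lB lR r t) (p.sArg r)) ∧
      pvIntegral (pvNum (p.B lB lR r t) (p.sArg r)) = Complex.I *
        (2 * Real.pi * p.lineAvg (p.B lB lR r t) r - Real.pi * (1 + p.B lB lR r t (p.sArg r)))) ∧
    (PVConverges (pvNum (p.dB_BS lB lR r t) (p.sArg r)) ∧
      pvIntegral (pvNum (p.dB_BS lB lR r t) (p.sArg r)) = Complex.I *
        (2 * Real.pi * p.lineAvg (p.dB_BS lB lR r t) r
          - Real.pi * p.dB_BS lB lR r t (p.sArg r))) ∧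
    (PVConverges (pvNum (p.dB_RIS lB lR r t) (p.sArg r)) ∧
      pvIntegral (pvNum (p.dB_RIS lB lR r t) (p.sArg r)) = Complex.I *
        (2 * Real.pi * p.lineAvg (p.dB_RIS lB lR r t) r
          - Real.pi * p.dB_RIS lB lR r t (p.sArg r))) := by
  obtain ⟨C, hC, hbd⟩ := exists_stripBound hp hroc (b := lB) (Λ := |lR|) hB
  have hr0 := hp.Rc_nonneg.trans hr
  have hbd' := hbd lB le_rfl lR le_rfl r hr t ht
  have hd := fun z h0 h1 => differentiableAt_strip hp hroc hr ht (z := z) h0 h1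
  refine ⟨?_, ?_, ?_⟩
  · have h := pv_of_stripBound hp (F := p.B lB lR r t) hC hr0 ht
      (fun z h0 h1 => differentiableAt_B (hd z h0 h1).1 (hd z h0 h1).2)
      (fun z h0 h1 => (hbd' z h0 h1).1)
    rwa [B_zero] at h
  · have h := pv_of_stripBound hp (F := p.dB_BS lB lR r t) hC hr0 ht
      (fun z h0 h1 =>
        ((differentiableAt_B (hd z h0 h1).1 (hd z h0 h1).2).mul (hd z h0 h1).1).fun_neg)
      (fun z h0 h1 => (hbd' z h0 h1).2.1)
    rwa [dB_BS_zero, zero_add] at h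
  · have h := pv_of_stripBound hp (F := p.dB_RIS lB lR r t) hC hr0 ht
      (fun z h0 h1 =>
        ((differentiableAt_B (hd z h0 h1).1 (hd z h0 h1).2).mul (hd z h0 h1).2).fun_neg)
      (fun z h0 h1 => (hbd' z h0 h1).2.2)
    rwa [dB_RIS_zero, zero_add] at h

/-- The coverage formula is an absolutely convergent average over the middle line of the strip: the
half residues at `0` and `s` cancel the terms outside the principal value. -/
theorem cov_eq_lineAvg (hp : p.Admissible)
    (hroc : ∀ r, p.Rc ≤ r → ∀ t : ℝ, 0 < t → p.sArg r ∈ p.roc r t) {lB : ℝ} (hB : 0 < lB) (lR : ℝ)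
    {r t : ℝ} (hr : p.Rc ≤ r) (ht : 0 < t) :
    p.cov lB lR r t = p.lineAvg (p.B lB lR r t) r ∧
    p.dCov_BS lB lR r t = p.lineAvg (p.dB_BS lB lR r t) r ∧
    p.dCov_RIS lB lR r t = p.lineAvg (p.dB_RIS lB lR r t) r := by
  obtain ⟨⟨-, h1⟩, ⟨-, h2⟩, ⟨-, h3⟩⟩ := pv_formulas hp hroc hB lR hr ht
  have hpi : (Real.pi : ℂ) ≠ 0 := by exact_mod_cast Real.pi_ne_zero
  have hI := Complex.I_ne_zero
  refine ⟨?_, ?_, ?_⟩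
  · rw [cov, h1]; field_simp; ring
  · rw [dCov_BS, h2]; field_simp; ring
  · rw [dCov_RIS, h3]; field_simp; ring

theorem measurable_midPt_slice {F : ℝ → ℝ → ℂ → ℂ}
    (hF : Measurable (fun q : (ℝ × ℝ) × ℝ => F q.1.2 q.1.1 (p.midPt q.1.2 q.2))) (r t : ℝ) :
    Measurable (fun v => F r t (p.midPt r v)) :=
  hF.comp (g := fun q : (ℝ × ℝ) × ℝ => F q.1.2 q.1.1 (p.midPt q.1.2 q.2))
    (f := fun v => ((t, r), v)) (by fun_prop)

/-- Bounds on the middle line, from those on the whole strip. -/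
theorem exists_midPt_bound (hp : p.Admissible)
    (hroc : ∀ r, p.Rc ≤ r → ∀ t : ℝ, 0 < t → p.sArg r ∈ p.roc r t) {b : ℝ} (hb : 0 < b) (Λ : ℝ) :
    ∃ C : ℝ, 0 ≤ C ∧ ∀ l, b ≤ l → ∀ lR, |lR| ≤ Λ → ∀ r, p.Rc ≤ r → ∀ t, 0 < t → ∀ v,
      ‖p.B l lR r t (p.midPt r v)‖ ≤ C * (r + 1) ^ p.α / (1 + t) ∧
      ‖p.dB_BS l lR r t (p.midPt r v)‖ ≤ C * (r + 1) ^ p.α / (1 + t) ∧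
      ‖p.dB_RIS l lR r t (p.midPt r v)‖ ≤ C * (r + 1) ^ p.α / (1 + t) := by
  obtain ⟨C, hC, hbd⟩ := exists_stripBound hp hroc (b := b) (Λ := Λ) hb
  refine ⟨2 * C, by positivity, fun l hl lR hlR r hr t ht v => ?_⟩
  have hr0 := hp.Rc_nonneg.trans hr
  have hs := sVal_pos hp hr0
  have hle := stripBound_midPt_le hp hC hr0 ht v
  obtain ⟨h1, h2, h3⟩ := hbd l hl lR hlR r hr t ht (p.midPt r v) (by rw [midPt_re]; positivity)
    (by rw [midPt_re]; linarith)
  exact ⟨h1.trans hle, h2.trans hle, h3.trans hle⟩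

theorem hasDerivAt_lineAvg_BS (hp : p.Admissible)
    (hroc : ∀ r, p.Rc ≤ r → ∀ t : ℝ, 0 < t → p.sArg r ∈ p.roc r t) {lB : ℝ} (hB : 0 < lB) (lR : ℝ)
    {r t : ℝ} (hr : p.Rc ≤ r) (ht : 0 < t) :
    HasDerivAt (fun l => p.lineAvg (p.B l lR r t) r) (p.lineAvg (p.dB_BS lB lR r t) r) lB := by
  obtain ⟨C, -, hbd⟩ := exists_midPt_bound hp hroc (half_pos hB) |lR|
  refine hasDerivAt_integral_mul_lineWeight (F := fun l v => p.B l lR r t (p.midPt r v))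
    (F' := fun l v => p.dB_BS l lR r t (p.midPt r v)) (s := Ioi (lB / 2))
    (Ioi_mem_nhds (half_lt_self hB))
    (fun l _ => measurable_midPt_slice (measurable_B_midPt hp l lR) r t)
    (measurable_midPt_slice (measurable_dB_BS_midPt hp lB lR) r t)
    (fun l hl v => (hbd l (le_of_lt hl) lR le_rfl r hr t ht v).1)
    (fun l hl v => (hbd l (le_of_lt hl) lR le_rfl r hr t ht v).2.1)
    (fun l _ v => hasDerivAt_B_BS l lR r t _)

theorem abs_le_of_mem_Ioo {x y : ℝ} (h : x ∈ Ioo (y - 1) (y + 1)) : |x| ≤ |y| + 1 := by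
  have h1 : |x - y| ≤ 1 := by rw [abs_le]; constructor <;> linarith [h.1, h.2]
  have h2 := abs_add_le (x - y) y
  rw [sub_add_cancel] at h2
  linarith

theorem Ioo_mem_nhds_self (y : ℝ) : Ioo (y - 1) (y + 1) ∈ 𝓝 y :=
  Ioo_mem_nhds (by linarith) (by linarith)

theorem hasDerivAt_lineAvg_RIS (hp : p.Admissible)
    (hroc : ∀ r, p.Rc ≤ r → ∀ t : ℝ, 0 < t → p.sArg r ∈ p.roc r t) {lB : ℝ} (hB : 0 < lB) (lR : ℝ)
    {r t : ℝ} (hr : p.Rc ≤ r) (ht : 0 < t) :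
    HasDerivAt (fun l => p.lineAvg (p.B lB l r t) r) (p.lineAvg (p.dB_RIS lB lR r t) r) lR := by
  obtain ⟨C, -, hbd⟩ := exists_midPt_bound hp hroc hB (|lR| + 1)
  refine hasDerivAt_integral_mul_lineWeight (F := fun l v => p.B lB l r t (p.midPt r v))
    (F' := fun l v => p.dB_RIS lB l r t (p.midPt r v)) (s := Ioo (lR - 1) (lR + 1))
    (Ioo_mem_nhds_self lR)
    (fun l _ => measurable_midPt_slice (measurable_B_midPt hp lB l) r t)
    (measurable_midPt_slice (measurable_dB_RIS_midPt hp lB lR) r t)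
    (fun l hl v => (hbd lB le_rfl l (abs_le_of_mem_Ioo hl) r hr t ht v).1)
    (fun l hl v => (hbd lB le_rfl l (abs_le_of_mem_Ioo hl) r hr t ht v).2.2)
    (fun l _ v => hasDerivAt_B_RIS lB l r t _)

theorem hasDerivAt_cov_BS (hp : p.Admissible)
    (hroc : ∀ r, p.Rc ≤ r → ∀ t : ℝ, 0 < t → p.sArg r ∈ p.roc r t) {lB : ℝ} (hB : 0 < lB) (lR : ℝ)
    {r t : ℝ} (hr : p.Rc ≤ r) (ht : 0 < t) :
    HasDerivAt (fun l => p.cov l lR r t) (p.dCov_BS lB lR r t) lB := by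
  rw [(cov_eq_lineAvg hp hroc hB lR hr ht).2.1]
  refine (hasDerivAt_lineAvg_BS hp hroc hB lR hr ht).congr_of_eventuallyEq ?_
  filter_upwards [Ioi_mem_nhds hB] with l hl
  exact (cov_eq_lineAvg hp hroc hl lR hr ht).1

theorem hasDerivAt_cov_RIS (hp : p.Admissible)
    (hroc : ∀ r, p.Rc ≤ r → ∀ t : ℝ, 0 < t → p.sArg r ∈ p.roc r t) {lB : ℝ} (hB : 0 < lB) (lR : ℝ)
    {r t : ℝ} (hr : p.Rc ≤ r) (ht : 0 < t) :
    HasDerivAt (fun l => p.cov lB l r t) (p.dCov_RIS lB lR r t) lR := by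
  rw [(cov_eq_lineAvg hp hroc hB lR hr ht).2.2]
  refine (hasDerivAt_lineAvg_RIS hp hroc hB lR hr ht).congr_of_eventuallyEq ?_
  filter_upwards with l
  exact (cov_eq_lineAvg hp hroc hB l hr ht).1

theorem hasDerivAt_pvIntegral_BS (hp : p.Admissible)
    (hroc : ∀ r, p.Rc ≤ r → ∀ t : ℝ, 0 < t → p.sArg r ∈ p.roc r t) {lB : ℝ} (hB : 0 < lB) (lR : ℝ)
    {r t : ℝ} (hr : p.Rc ≤ r) (ht : 0 < t) :
    HasDerivAt (fun l : ℝ => pvIntegral (pvNum (p.B l lR r t) (p.sArg r)))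
      (pvIntegral (pvNum (p.dB_BS lB lR r t) (p.sArg r))) lB := by
  rw [(pv_formulas hp hroc hB lR hr ht).2.1.2]
  refine ((((hasDerivAt_lineAvg_BS hp hroc hB lR hr ht).const_mul (2 * (Real.pi : ℂ))).sub
    (((hasDerivAt_B_BS lB lR r t (p.sArg r)).const_add 1).const_mul (Real.pi : ℂ))).const_mul
      Complex.I).congr_of_eventuallyEq ?_
  filter_upwards [Ioi_mem_nhds hB] with l hl
  exact (pv_formulas hp hroc hl lR hr ht).1.2

theorem hasDerivAt_pvIntegral_RIS (hp : p.Admissible)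
    (hroc : ∀ r, p.Rc ≤ r → ∀ t : ℝ, 0 < t → p.sArg r ∈ p.roc r t) {lB : ℝ} (hB : 0 < lB) (lR : ℝ)
    {r t : ℝ} (hr : p.Rc ≤ r) (ht : 0 < t) :
    HasDerivAt (fun l : ℝ => pvIntegral (pvNum (p.B lB l r t) (p.sArg r)))
      (pvIntegral (pvNum (p.dB_RIS lB lR r t) (p.sArg r))) lR := by
  rw [(pv_formulas hp hroc hB lR hr ht).2.2.2]
  refine ((((hasDerivAt_lineAvg_RIS hp hroc hB lR hr ht).const_mul (2 * (Real.pi : ℂ))).sub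
    (((hasDerivAt_B_RIS lB lR r t (p.sArg r)).const_add 1).const_mul (Real.pi : ℂ))).const_mul
      Complex.I).congr_of_eventuallyEq ?_
  filter_upwards with l
  exact (pv_formulas hp hroc hB l hr ht).1.2

theorem cov_im (hp : p.Admissible)
    (hroc : ∀ r, p.Rc ≤ r → ∀ t : ℝ, 0 < t → p.sArg r ∈ p.roc r t) {lB : ℝ} (hB : 0 < lB) (lR : ℝ)
    {r t : ℝ} (hr : p.Rc ≤ r) (ht : 0 < t) : (p.cov lB lR r t).im = 0 := by
  rw [(cov_eq_lineAvg hp hroc hB lR hr ht).1, ← Complex.conj_eq_iff_im]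
  exact lineAvg_conj (B_conj lB lR r t) r

theorem hasDerivAt_rateR_BS (hp : p.Admissible)
    (hroc : ∀ r, p.Rc ≤ r → ∀ t : ℝ, 0 < t → p.sArg r ∈ p.roc r t) {lB : ℝ} (hB : 0 < lB) (lR : ℝ)
    {r t : ℝ} (hr : p.Rc ≤ r) (ht : 0 < t) :
    HasDerivAt (fun l => p.rateR l lR t r) (p.dRateR_BS lB lR t r) lB := by
  have h1 : HasDerivAt (fun l : ℝ => 2 * Real.pi * l * r * Real.exp (-(Real.pi * r ^ 2 * l)))
      ((1 - Real.pi * r ^ 2 * lB) * (2 * Real.pi * r * Real.exp (-(Real.pi * r ^ 2 * lB)))) lB := by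
    have e1 : HasDerivAt (fun l : ℝ => 2 * Real.pi * l * r) (2 * Real.pi * r) lB := by
      simpa using ((hasDerivAt_id lB).const_mul (2 * Real.pi)).mul_const r
    have e2 : HasDerivAt (fun l : ℝ => -(Real.pi * r ^ 2 * l)) (-(Real.pi * r ^ 2)) lB := by
      simpa using ((hasDerivAt_id lB).const_mul (Real.pi * r ^ 2)).fun_neg
    refine (e1.mul e2.exp).congr_deriv ?_
    ring
  refine ((hasDerivAt_cov_BS hp hroc hB lR hr ht).mul h1.ofReal_comp).congr_deriv ?_
  rw [dRateR_BS]
  push_cast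
  ring

theorem hasDerivAt_rateR_RIS (hp : p.Admissible)
    (hroc : ∀ r, p.Rc ≤ r → ∀ t : ℝ, 0 < t → p.sArg r ∈ p.roc r t) {lB : ℝ} (hB : 0 < lB) (lR : ℝ)
    {r t : ℝ} (hr : p.Rc ≤ r) (ht : 0 < t) :
    HasDerivAt (fun l => p.rateR lB l t r) (p.dRateR_RIS lB lR t r) lR :=
  (hasDerivAt_cov_RIS hp hroc hB lR hr ht).mul_const _

theorem exists_measurable_rateR (hp : p.Admissible)
    (hroc : ∀ r, p.Rc ≤ r → ∀ t : ℝ, 0 < t → p.sArg r ∈ p.roc r t) {lB : ℝ} (hB : 0 < lB)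
    (lR : ℝ) :
    (∃ Ψ : ℝ × ℝ → ℂ, Measurable Ψ ∧ ∀ t > 0, ∀ r > p.Rc, p.rateR lB lR t r = Ψ (t, r)) ∧
    (∃ Ψ : ℝ × ℝ → ℂ, Measurable Ψ ∧ ∀ t > 0, ∀ r > p.Rc, p.dRateR_BS lB lR t r = Ψ (t, r)) ∧
    (∃ Ψ : ℝ × ℝ → ℂ, Measurable Ψ ∧ ∀ t > 0, ∀ r > p.Rc, p.dRateR_RIS lB lR t r = Ψ (t, r)) := by
  have m1 := measurable_lineAvg (F := p.B lB lR) (measurable_B_midPt hp lB lR)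
  have m2 := measurable_lineAvg (F := p.dB_BS lB lR) (measurable_dB_BS_midPt hp lB lR)
  have m3 := measurable_lineAvg (F := p.dB_RIS lB lR) (measurable_dB_RIS_midPt hp lB lR)
  refine ⟨⟨fun q => p.lineAvg (p.B lB lR q.2 q.1) q.2 *
      ((2 * Real.pi * lB * q.2 * Real.exp (-(Real.pi * q.2 ^ 2 * lB)) : ℝ) : ℂ),
      m1.mul (by fun_prop), fun t ht r hr => ?_⟩,
    ⟨fun q => (p.lineAvg (p.dB_BS lB lR q.2 q.1) q.2 * (lB : ℂ) +
        p.lineAvg (p.B lB lR q.2 q.1) q.2 * ((1 - Real.pi * q.2 ^ 2 * lB : ℝ) : ℂ)) *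
      ((2 * Real.pi * q.2 * Real.exp (-(Real.pi * q.2 ^ 2 * lB)) : ℝ) : ℂ),
      ((m2.mul_const _).add (m1.mul (by fun_prop))).mul (by fun_prop), fun t ht r hr => ?_⟩,
    ⟨fun q => p.lineAvg (p.dB_RIS lB lR q.2 q.1) q.2 *
      ((2 * Real.pi * lB * q.2 * Real.exp (-(Real.pi * q.2 ^ 2 * lB)) : ℝ) : ℂ),
      m3.mul (by fun_prop), fun t ht r hr => ?_⟩⟩
  · rw [rateR, (cov_eq_lineAvg hp hroc hB lR hr.le ht).1]
  · rw [dRateR_BS, (cov_eq_lineAvg hp hroc hB lR hr.le ht).1,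
      (cov_eq_lineAvg hp hroc hB lR hr.le ht).2.1]
  · rw [dRateR_RIS, (cov_eq_lineAvg hp hroc hB lR hr.le ht).2.2]

/-- The rate densities are dominated by a Gaussian in `r` times `1 / (1 + t)`, locally uniformly in
the densities of the two point processes. -/
theorem exists_rate_bound (hp : p.Admissible)
    (hroc : ∀ r, p.Rc ≤ r → ∀ t : ℝ, 0 < t → p.sArg r ∈ p.roc r t) {b b' : ℝ} (hb : 0 < b)
    (hbb' : b ≤ b') (Λ : ℝ) :
    ∃ D : ℝ → ℝ, IntegrableOn D (Ioi p.Rc) ∧ ∀ l ∈ Icc b b', ∀ lR, |lR| ≤ Λ →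
      ∀ t > 0, ∀ r > p.Rc,
      ‖p.rateR l lR t r‖ ≤ D r / (1 + t) ∧ ‖p.dRateR_BS l lR t r‖ ≤ D r / (1 + t) ∧
      ‖p.dRateR_RIS l lR t r‖ ≤ D r / (1 + t) := by
  obtain ⟨C, hC, hbd⟩ := exists_midPt_bound hp hroc hb Λ
  obtain ⟨K, hK, hgauss⟩ := exists_gaussian_bound (α := p.α) (b := b) (b' := b')
    (by linarith [hp.two_lt_α]) hb (hb.trans_le hbb')
  have hpi := Real.pi_pos
  obtain ⟨κ, hκ, hκ0⟩ : ∃ κ, κ = ∫ v, lineWeight v ∧ 0 ≤ κ :=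
    ⟨_, rfl, integral_nonneg lineWeight_nonneg⟩
  refine ⟨fun r => C * κ * (K * Real.exp (-(Real.pi * b / 2) * r ^ 2)),
    (((integrable_exp_neg_mul_sq (by positivity)).const_mul K).const_mul _).integrableOn, ?_⟩
  intro l hl lR hlR t ht r hr
  have hl0 : 0 < l := hb.trans_le hl.1
  have hr0 : 0 ≤ r := hp.Rc_nonneg.trans hr.le
  have hm := hbd l hl.1 lR hlR r hr.le t ht
  obtain ⟨e1, e2, e3⟩ := cov_eq_lineAvg hp hroc hl0 lR hr.le ht
  have c1 : ‖p.cov l lR r t‖ ≤ C * (r + 1) ^ p.α / (1 + t) * κ := by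
    rw [e1, hκ]; exact norm_integral_mul_lineWeight_le fun v => (hm v).1
  have c2 : ‖p.dCov_BS l lR r t‖ ≤ C * (r + 1) ^ p.α / (1 + t) * κ := by
    rw [e2, hκ]; exact norm_integral_mul_lineWeight_le fun v => (hm v).2.1
  have c3 : ‖p.dCov_RIS l lR r t‖ ≤ C * (r + 1) ^ p.α / (1 + t) * κ := by
    rw [e3, hκ]; exact norm_integral_mul_lineWeight_le fun v => (hm v).2.2
  have hρ : 0 ≤ (r + 1) ^ p.α := Real.rpow_nonneg (by linarith) _
  obtain ⟨W, hW⟩ : ∃ W, W = C * (r + 1) ^ p.α / (1 + t) * κ := ⟨_, rfl⟩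
  have hW0 : 0 ≤ W := by rw [hW]; positivity
  rw [← hW] at c1 c2 c3
  obtain ⟨Q, hQ⟩ : ∃ Q, Q = b' + 1 + Real.pi * r ^ 2 * b' := ⟨_, rfl⟩
  have hb'0 : 0 < b' := hb.trans_le hbb'
  have hπr : 0 ≤ Real.pi * r ^ 2 := by positivity
  have hlb : Real.pi * r ^ 2 * l ≤ Real.pi * r ^ 2 * b' := mul_le_mul_of_nonneg_left hl.2 hπr
  have hexp : Real.exp (-(Real.pi * r ^ 2 * l)) ≤ Real.exp (-(Real.pi * r ^ 2 * b)) :=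
    Real.exp_le_exp.2 (neg_le_neg (mul_le_mul_of_nonneg_left hl.1 hπr))
  have hQ0 : 0 ≤ Q := by rw [hQ]; positivity
  have hfin : W * (Q * (2 * Real.pi * r)) * Real.exp (-(Real.pi * r ^ 2 * b)) ≤
      C * κ * (K * Real.exp (-(Real.pi * b / 2) * r ^ 2)) / (1 + t) := by
    have h := hgauss r hr0
    rw [← hQ] at h
    calc _ = C * κ * ((r + 1) ^ p.α * (Q * (2 * Real.pi * r)) *
          Real.exp (-(Real.pi * r ^ 2 * b))) / (1 + t) := by rw [hW]; ring
      _ ≤ _ := by gcongr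
  have hdens : ∀ x : ℂ, ‖x‖ ≤ W →
      ‖x * ((2 * Real.pi * l * r * Real.exp (-(Real.pi * r ^ 2 * l)) : ℝ) : ℂ)‖ ≤
        C * κ * (K * Real.exp (-(Real.pi * b / 2) * r ^ 2)) / (1 + t) := by
    intro x hx
    refine le_trans ?_ hfin
    have hlQ : l ≤ Q := by
      have := mul_nonneg hπr hb'0.le
      rw [hQ]; linarith [hl.2]
    rw [norm_mul, Complex.norm_real, Real.norm_of_nonneg (by positivity)]
    calc _ ≤ W * (2 * Real.pi * Q * r * Real.exp (-(Real.pi * r ^ 2 * b))) := by gcongr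
      _ = _ := by ring
  refine ⟨hdens _ c1, ?_, hdens _ c3⟩
  refine le_trans ?_ hfin
  have hnum : ‖p.dCov_BS l lR r t * (l : ℂ) +
      p.cov l lR r t * ((1 - Real.pi * r ^ 2 * l : ℝ) : ℂ)‖ ≤ W * Q := by
    refine (norm_add_le _ _).trans ?_
    rw [norm_mul, norm_mul, Complex.norm_real, Complex.norm_real, Real.norm_of_nonneg hl0.le]
    have h1 : ‖1 - Real.pi * r ^ 2 * l‖ ≤ 1 + Real.pi * r ^ 2 * b' := by
      rw [Real.norm_eq_abs, abs_le]
      have := mul_nonneg hπr hl0.le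
      constructor <;> linarith
    calc _ ≤ W * b' + W * (1 + Real.pi * r ^ 2 * b') := by
          gcongr
          exact hl.2
      _ = W * Q := by rw [hQ]; ring
  rw [dRateR_BS, norm_mul, Complex.norm_real, Real.norm_of_nonneg (by positivity)]
  calc _ ≤ W * Q * (2 * Real.pi * r * Real.exp (-(Real.pi * r ^ 2 * b))) := by gcongr
    _ = _ := by ring

end RISNetwork

end

/-! ### Derivatives of the ergodic rate -/

theorem mainTheorem1 (p : RISNetwork) (hp : p.Admissible)
    (hroc : ∀ r, p.Rc ≤ r → ∀ t : ℝ, 0 < t → p.sArg r ∈ p.roc r t)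
    (lB lR : ℝ) (hB : 0 < lB) (hR : 0 ≤ lR) :
    -- closed forms of the Laplace transforms of the fading powers
    (∀ w : ℂ, -1 < w.re → RISNetwork.LD w = 1 / (1 + w)) ∧
    (∀ w : ℂ, -1 < 2 * (p.M * p.varZ) * w.re →
      p.LR w = Complex.exp (-(w * ((p.M * p.meanZ : ℝ) : ℂ) ^ 2)
          / (1 + 2 * w * ((p.M * p.varZ : ℝ) : ℂ)))
        / (1 + 2 * w * ((p.M * p.varZ : ℝ) : ℂ)) ^ (1 / 2 : ℂ)) ∧
    (∀ r, p.Rc ≤ r → ∀ t : ℝ, 0 < t →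
      -- derivatives of the Laplace transform of `Υ` on its region of convergence
      (∀ z ∈ p.roc r t,
        IntegrableOn (fun x : ℝ => (x : ℂ) *
          (1 - RISNetwork.LD (z * ((t * p.P₀ * p.g x : ℝ) : ℂ)))) (Ioi r) ∧
        IntegrableOn (fun q : ℝ × ℝ => (q.1 : ℂ) *
          (1 - p.LR (-(z * ((p.P₀ * p.G r q.1 q.2 : ℝ) : ℂ)))))
          (Icc p.Rin p.Rout ×ˢ Icc (0 : ℝ) (2 * Real.pi)) ∧
        HasDerivAt (fun l : ℝ => p.B l lR r t z)
          (-p.B lB lR r t z * (2 * (Real.pi : ℂ) *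
            ∫ x in Ioi r, (x : ℂ) *
              (1 - RISNetwork.LD (z * ((t * p.P₀ * p.g x : ℝ) : ℂ))))) lB ∧
        HasDerivAt (fun l : ℝ => p.B lB l r t z)
          (-p.B lB lR r t z *
            ∫ y in p.Rin..p.Rout, ∫ ψ in (0 : ℝ)..(2 * Real.pi),
              (y : ℂ) * (1 - p.LR (-(z * ((p.P₀ * p.G r y ψ : ℝ) : ℂ))))) lR) ∧
      -- the singular integrals converge, and the derivatives may be taken under them
      PVConverges (pvNum (p.B lB lR r t) (p.sArg r)) ∧
      PVConverges (pvNum (p.dB_BS lB lR r t) (p.sArg r)) ∧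
      PVConverges (pvNum (p.dB_RIS lB lR r t) (p.sArg r)) ∧
      HasDerivAt (fun l : ℝ => pvIntegral (pvNum (p.B l lR r t) (p.sArg r)))
        (pvIntegral (pvNum (p.dB_BS lB lR r t) (p.sArg r))) lB ∧
      HasDerivAt (fun l : ℝ => pvIntegral (pvNum (p.B lB l r t) (p.sArg r)))
        (pvIntegral (pvNum (p.dB_RIS lB lR r t) (p.sArg r))) lR ∧
      -- the coverage formula is real, with the stated derivatives
      (p.cov lB lR r t).im = 0 ∧
      HasDerivAt (fun l : ℝ => p.cov l lR r t) (p.dCov_BS lB lR r t) lB ∧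
      HasDerivAt (fun l : ℝ => p.cov lB l r t) (p.dCov_RIS lB lR r t) lR) ∧
    -- the integrals over `r` converge, and the derivatives may be taken under them
    (∀ t : ℝ, 0 < t →
      IntegrableOn (p.rateR lB lR t) (Ioi p.Rc) ∧
      IntegrableOn (p.dRateR_BS lB lR t) (Ioi p.Rc) ∧
      IntegrableOn (p.dRateR_RIS lB lR t) (Ioi p.Rc) ∧
      HasDerivAt (fun l : ℝ => ∫ r in Ioi p.Rc, p.rateR l lR t r)
        (∫ r in Ioi p.Rc, p.dRateR_BS lB lR t r) lB ∧
      HasDerivAt (fun l : ℝ => ∫ r in Ioi p.Rc, p.rateR lB l t r)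
        (∫ r in Ioi p.Rc, p.dRateR_RIS lB lR t r) lR) ∧
    -- the integrals over `t` converge, and the derivatives of the rate are as stated
    IntegrableOn (fun t : ℝ =>
      (∫ r in Ioi p.Rc, p.rateR lB lR t r) * ((1 / (1 + t) : ℝ) : ℂ)) (Ioi 0) ∧
    IntegrableOn (fun t : ℝ =>
      (∫ r in Ioi p.Rc, p.dRateR_BS lB lR t r) * ((1 / (1 + t) : ℝ) : ℂ)) (Ioi 0) ∧
    IntegrableOn (fun t : ℝ =>
      (∫ r in Ioi p.Rc, p.dRateR_RIS lB lR t r) * ((1 / (1 + t) : ℝ) : ℂ)) (Ioi 0) ∧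
    HasDerivAt (fun l : ℝ => p.tau l lR)
      (∫ t in Ioi (0 : ℝ),
        (∫ r in Ioi p.Rc,
          (p.dCov_BS lB lR r t * (lB : ℂ)
            + p.cov lB lR r t * ((1 - Real.pi * r ^ 2 * lB : ℝ) : ℂ))
          * ((2 * Real.pi * r * Real.exp (-(Real.pi * r ^ 2 * lB)) : ℝ) : ℂ))
        * ((1 / (1 + t) : ℝ) : ℂ)) lB ∧
    HasDerivAt (fun l : ℝ => p.tau lB l)
      (∫ t in Ioi (0 : ℝ),
        (∫ r in Ioi p.Rc,
          p.dCov_RIS lB lR r t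
          * ((2 * Real.pi * lB * r * Real.exp (-(Real.pi * r ^ 2 * lB)) : ℝ) : ℂ))
        * ((1 / (1 + t) : ℝ) : ℂ)) lR
 := by
  refine ⟨fun w hw => RISNetwork.LD_eq hw, fun w hw => ?_, fun r hr t ht => ?_, ?_⟩
  · have h := complexMGF_sq_gaussianReal (μ := p.M * p.meanZ) (V := p.M * p.varZ) (w := w)
      (by push_cast; exact hw)
    rw [RISNetwork.LR, h]
    push_cast
    rfl
  · obtain ⟨⟨a1, -⟩, ⟨a2, -⟩, ⟨a3, -⟩⟩ := RISNetwork.pv_formulas hp hroc hB lR hr ht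
    refine ⟨fun z hz => ⟨?_, ?_, ?_, ?_⟩, a1, a2, a3,
      RISNetwork.hasDerivAt_pvIntegral_BS hp hroc hB lR hr ht,
      RISNetwork.hasDerivAt_pvIntegral_RIS hp hroc hB lR hr ht,
      RISNetwork.cov_im hp hroc hB lR hr ht, RISNetwork.hasDerivAt_cov_BS hp hroc hB lR hr ht,
      RISNetwork.hasDerivAt_cov_RIS hp hroc hB lR hr ht⟩
    · exact RISNetwork.integrableOn_expoBS hp (hp.Rc_nonneg.trans hr) ht (hz.1 r le_rfl)
    · exact RISNetwork.integrableOn_expoRIS hp fun q hq => hz.2 q.1 hq.1 q.2 hq.2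
    · refine (RISNetwork.hasDerivAt_B_BS lB lR r t z).congr_deriv ?_
      rw [RISNetwork.dB_BS, neg_mul, RISNetwork.expoBS]
    · refine (RISNetwork.hasDerivAt_B_RIS lB lR r t z).congr_deriv ?_
      rw [RISNetwork.dB_RIS, neg_mul, RISNetwork.expoRIS]
  have hb : lB / 2 ≤ 2 * lB := by linarith
  obtain ⟨D₁, hD₁, hd₁⟩ := RISNetwork.exists_rate_bound hp hroc (half_pos hB) hb |lR|
  obtain ⟨D₂, hD₂, hd₂⟩ := RISNetwork.exists_rate_bound hp hroc hB le_rfl (|lR| + 1)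
  have hlB : lB ∈ Icc lB lB := ⟨le_rfl, le_rfl⟩
  have hpos : ∀ l ∈ Ioo (lB / 2) (2 * lB), 0 < l := fun l hl => (half_pos hB).trans hl.1
  obtain ⟨h1, h2, h3, h4⟩ := hasDerivAt_iterated_integral (Φ := fun l t r => p.rateR l lR t r)
    (Φ' := fun l t r => p.dRateR_BS l lR t r) (s := Ioo (lB / 2) (2 * lB)) (l := lB) (a := p.Rc)
    (Ioo_mem_nhds (by linarith) (by linarith)) hD₁
    (fun l hl => (RISNetwork.exists_measurable_rateR hp hroc (hpos l hl) lR).1)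
    (fun l hl t ht r hr => (hd₁ l (Ioo_subset_Icc_self hl) lR le_rfl t ht r hr).1)
    (fun l hl t ht r hr => (hd₁ l (Ioo_subset_Icc_self hl) lR le_rfl t ht r hr).2.1)
    (fun l hl t ht r hr =>
      RISNetwork.hasDerivAt_rateR_BS hp hroc (hpos l hl) lR (le_of_lt hr) ht)
    (fun l hl => (RISNetwork.exists_measurable_rateR hp hroc (hpos l hl) lR).2.1)
  obtain ⟨k1, k2, k3, k4⟩ := hasDerivAt_iterated_integral (Φ := fun l t r => p.rateR lB l t r)
    (Φ' := fun l t r => p.dRateR_RIS lB l t r) (s := Ioo (lR - 1) (lR + 1)) (l := lR) (a := p.Rc)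
    (RISNetwork.Ioo_mem_nhds_self lR) hD₂
    (fun l _ => (RISNetwork.exists_measurable_rateR hp hroc hB l).1)
    (fun l hl t ht r hr => (hd₂ lB hlB l (RISNetwork.abs_le_of_mem_Ioo hl) t ht r hr).1)
    (fun l hl t ht r hr => (hd₂ lB hlB l (RISNetwork.abs_le_of_mem_Ioo hl) t ht r hr).2.2)
    (fun l _ t ht r hr => RISNetwork.hasDerivAt_rateR_RIS hp hroc hB l (le_of_lt hr) ht)
    (fun l _ => (RISNetwork.exists_measurable_rateR hp hroc hB l).2.2)
  exact ⟨fun t ht => ⟨(h1 t ht).1, (h1 t ht).2.1, (k1 t ht).2.1, (h1 t ht).2.2, (k1 t ht).2.2⟩,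
    h2, h3, k3, h4, k4⟩
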